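/- Let $X$ be a complex smooth projective variety of dimension $n\ge 2$, let $B\subset X$ be a smooth divisor, and let $M$ be a line bundle on $X$ with an isomorphism $\varphi\colon\mathcal O_X(B)\cong M^{\otimes 2}$. Let $\pi\colon Y\to X$ be the double cover branched along $B$ defined by $M^{\otimes 2}$, that is, $Y=\mathrm{Spec}_X(\mathcal O_X\oplus M^{-1})$, where the product of two local sections $m,m'$ of $M^{-1}$ is the local function $\langle m\otimes m',\varphi(1_B)\rangle$; here $1_B\in H^0(X,\mathcal O_X(B))$ is the canonical section vanishing exactly on $B$. Let $H$ be a very ample line bundle on $X$. Then the line bundle $\tilde H=\pi^*H$ is very ample on $Y$ if and only if $H\otimes M^{-1}$ is generated by global sections on $X$. -/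

import Mathlib

open scoped TensorProduct
open CategoryTheory Opposite TopologicalSpace AlgebraicGeometry

noncomputable section

namespace DoubleCover

/-! ### Modules over a scheme -/

variable {X : Scheme.{0}}

/-- Restriction of functions from `U` to a smaller open set `V`. -/
abbrev resO {U V : X.Opens} (h : V ≤ U) : Γ(X, U) →+* Γ(X, V) :=
  (X.presheaf.map (homOfLE h).op).hom

/-- Restriction of sections of an `O_X`-module from `U` to a smaller open set `V`. -/
abbrev res {M : X.Modules} {U V : X.Opens} (h : V ≤ U) : Γ(M, U) →+ Γ(M, V) :=
  (M.presheaf.map (homOfLE h).op).hom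

/-- The structure sheaf `O_X` as a module over itself. -/
abbrev structureModule (X : Scheme.{0}) : X.Modules := SheafOfModules.unit X.ringCatSheaf

/-- A section `e ∈ Γ(M, U)` is a frame if `r ↦ r • e` is an isomorphism `O_U ≅ M|_U`. -/
def IsFrame {M : X.Modules} {U : X.Opens} (e : Γ(M, U)) : Prop :=
  ∀ (V : X.Opens) (h : V ≤ U), Function.Bijective fun r : Γ(X, V) => r • res h e

/-- A line bundle (invertible sheaf): an `O_X`-module locally isomorphic to `O_X`. -/
def IsLineBundle (M : X.Modules) : Prop :=
  ∀ x : X, ∃ (U : X.Opens) (e : Γ(M, U)), x ∈ U ∧ IsFrame e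

/-- Generated by global sections. -/
def IsGloballyGenerated (M : X.Modules) : Prop :=
  Nonempty (SheafOfModules.GeneratingSections (M : SheafOfModules X.ringCatSheaf))

/-- The presheaf `U ↦ M(U) ⊗_{O(U)} N(U)`. -/
def tensorPresheaf (M N : X.Modules) : X.PresheafOfModules :=
  PresheafOfModules.Monoidal.tensorObj (R := X.presheaf) M.val N.val

/-- The tensor product `M ⊗ N` of `O_X`-modules. -/
def tensor (M N : X.Modules) : X.Modules :=
  (PresheafOfModules.sheafification (𝟙 X.ringCatSheaf.obj)).obj (tensorPresheaf M N)

/-- The section `m ⊗ n` of `M ⊗ N`. -/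
def tmul {M N : X.Modules} {U : X.Opens} (m : Γ(M, U)) (n : Γ(N, U)) : Γ(tensor M N, U) :=
  ((PresheafOfModules.sheafificationAdjunction (𝟙 X.ringCatSheaf.obj)).unit.app
    (tensorPresheaf M N)).app (op U)
      (show ((tensorPresheaf M N).obj (op U) : Type) from m ⊗ₜ[Γ(X, U)] n)

/-! ### Dual modules -/

/-- Sections over `U` of the sheaf `Hom(P, O_X)`, for a presheaf of modules `P`: families of
additive maps `P(V) → O(V)` indexed by the open sets `V ⊆ U`. -/
abbrev DualFamily (P : X.PresheafOfModules) (U : X.Opens) : Type :=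
  ∀ V : {V : X.Opens // V ≤ U}, P.presheaf.obj (op V.1) →+ Γ(X, V.1)

/-- Scalar multiplication on the sections of a presheaf of modules. -/
def psmul {P : X.PresheafOfModules} {V : X.Opens} (r : Γ(X, V))
    (m : P.presheaf.obj (op V)) : P.presheaf.obj (op V) :=
  (show X.ringCatSheaf.obj.obj (op V) from r) • (show P.obj (op V) from m)

/-- The families that are `O`-linear and compatible with restriction. -/
def dualSections (P : X.PresheafOfModules) (U : X.Opens) : AddSubgroup (DualFamily P U) where
  carrier := {f |
    (∀ (V : {V : X.Opens // V ≤ U}) (r : Γ(X, V.1)) (m : P.presheaf.obj (op V.1)), f V (psmul r m) = r * f V m) ∧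
    (∀ (V W : {V : X.Opens // V ≤ U}) (h : W.1 ≤ V.1) (m : P.presheaf.obj (op V.1)),
      f W (P.presheaf.map (homOfLE h).op m) = resO h (f V m))}
  zero_mem' := ⟨fun _ r _ => (mul_zero r).symm, fun _ _ h _ => (map_zero (resO h)).symm⟩
  add_mem' := by
    rintro f g ⟨hf, hf'⟩ ⟨hg, hg'⟩
    refine ⟨fun V r m => ?_, fun V W h m => ?_⟩
    · simp only [Pi.add_apply, AddMonoidHom.add_apply]
      rw [mul_add]
      exact congrArg₂ _ (hf V r m) (hg V r m)
    · simp only [Pi.add_apply, AddMonoidHom.add_apply, map_add]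
      exact congrArg₂ _ (hf' V W h m) (hg' V W h m)
  neg_mem' := by
    rintro f ⟨hf, hf'⟩
    refine ⟨fun V r m => ?_, fun V W h m => ?_⟩
    · simp only [Pi.neg_apply, AddMonoidHom.neg_apply]
      rw [mul_neg]
      exact congrArg _ (hf V r m)
    · simp only [Pi.neg_apply, AddMonoidHom.neg_apply, map_neg]
      exact congrArg _ (hf' V W h m)

lemma resO_resO {U V W : X.Opens} (h : V ≤ U) (h' : W ≤ V) (r : Γ(X, U)) :
    resO h' (resO h r) = resO (h'.trans h) r := by
  simp only [resO, ← RingHom.comp_apply, ← CommRingCat.hom_comp, ← Functor.map_comp]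
  rfl

lemma resO_self {U : X.Opens} (r : Γ(X, U)) : resO (le_refl U) r = r := by
  simp [resO]

instance (P : X.PresheafOfModules) (U : X.Opens) : Module Γ(X, U) (dualSections P U) where
  smul r f := ⟨fun V => (AddMonoidHom.mulLeft (resO V.2 r)).comp (f.1 V), by
    obtain ⟨f, hf, hf'⟩ := f
    refine ⟨fun V s m => ?_, fun V W h m => ?_⟩
    · refine (congrArg (resO V.2 r * ·) (hf V s m)).trans ?_
      exact mul_left_comm _ _ _
    · refine (congrArg (resO W.2 r * ·) (hf' V W h m)).trans ?_
      refine (congrArg (· * resO h (f V m)) (resO_resO V.2 h r).symm).trans ?_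
      exact (map_mul (resO h) _ _).symm⟩
  one_smul f := by
    ext V m
    exact (congrArg (· * f.1 V m) (map_one (resO V.2))).trans (one_mul _)
  mul_smul r s f := by
    ext V m
    exact (congrArg (· * f.1 V m) (map_mul (resO V.2) r s)).trans (mul_assoc _ _ _)
  smul_zero r := by
    ext V m
    exact mul_zero (resO V.2 r)
  smul_add r f g := by
    ext V m
    exact mul_add (resO V.2 r) _ _
  add_smul r s f := by
    ext V m
    exact (congrArg (· * f.1 V m) (map_add (resO V.2) r s)).trans (add_mul _ _ _)
  zero_smul f := by
    ext V m
    exact (congrArg (· * f.1 V m) (map_zero (resO V.2))).trans (zero_mul _)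

/-- Restriction of sections of the dual. -/
def dualRes (P : X.PresheafOfModules) {U V : X.Opens} (h : V ≤ U) :
    dualSections P U →+ dualSections P V where
  toFun f := ⟨fun W => f.1 ⟨W.1, W.2.trans h⟩,
    fun W r m => f.2.1 ⟨W.1, W.2.trans h⟩ r m,
    fun W W' i m => f.2.2 ⟨W.1, W.2.trans h⟩ ⟨W'.1, W'.2.trans h⟩ i m⟩
  map_zero' := rfl
  map_add' _ _ := rfl

/-- The presheaf of abelian groups `U ↦ Hom(P|_U, O_U)`. -/
def dualAb (P : X.PresheafOfModules) : X.Opensᵒᵖ ⥤ Ab.{0} where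
  obj U := AddCommGrpCat.of (dualSections P U.unop)
  map i := AddCommGrpCat.ofHom (dualRes P i.unop.le)
  map_id U := by
    ext f
    rfl
  map_comp i j := by
    ext f
    rfl

instance (P : X.PresheafOfModules) (U : X.Opensᵒᵖ) :
    Module (X.ringCatSheaf.obj.obj U) ((dualAb P).obj U) :=
  inferInstanceAs (Module Γ(X, U.unop) (dualSections P U.unop))

/-- The presheaf of modules `U ↦ Hom(P|_U, O_U)`. -/
def dualPresheaf (P : X.PresheafOfModules) : X.PresheafOfModules :=
  PresheafOfModules.ofPresheaf (R := X.ringCatSheaf.obj) (dualAb P) (fun U V i r f => by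
    apply Subtype.ext
    funext W
    ext m
    exact (congrArg (· * _) (resO_resO i.unop.le W.2 r)).symm)

/-- Restriction of sections of a presheaf of modules. -/
abbrev pres (P : X.PresheafOfModules) {U V : X.Opens} (h : V ≤ U) :
    P.presheaf.obj (op U) →+ P.presheaf.obj (op V) :=
  (P.presheaf.map (homOfLE h).op).hom

lemma pres_pres (P : X.PresheafOfModules) {U V W : X.Opens} (h : V ≤ U) (h' : W ≤ V)
    (m : P.presheaf.obj (op U)) : pres P h' (pres P h m) = pres P (h'.trans h) m := by
  have := P.presheaf.map_comp (homOfLE h).op (homOfLE h').op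
  exact (congrArg (fun t => t.hom m) this).symm

lemma pres_psmul (P : X.PresheafOfModules) {U V : X.Opens} (h : V ≤ U) (r : Γ(X, U))
    (m : P.presheaf.obj (op U)) : pres P h (psmul r m) = psmul (resO h r) (pres P h m) :=
  P.map_smul (homOfLE h).op r m

lemma eq_of_resO_eq {ι : Type*} (U : ι → X.Opens) {V : X.Opens} (hU : ∀ i, U i ≤ V)
    (hV : V ≤ iSup U) {s t : Γ(X, V)} (h : ∀ i, resO (hU i) s = resO (hU i) t) : s = t :=
  X.sheaf.eq_of_locally_eq' U V (fun i => homOfLE (hU i)) hV s t h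

lemma dualAb_isSheaf (P : X.PresheafOfModules) : TopCat.Presheaf.IsSheaf (X := X) (dualAb P) := by
  rw [TopCat.Presheaf.isSheaf_iff_isSheafUniqueGluing]
  intro ι U sf hsf
  let sf' : ∀ i, dualSections P (U i) := sf
  have key : ∀ (i j : ι) (Z : X.Opens) (hi : Z ≤ U i) (hj : Z ≤ U j) (m : P.presheaf.obj (op Z)),
      (sf' i).1 ⟨Z, hi⟩ m = (sf' j).1 ⟨Z, hj⟩ m := by
    intro i j Z hi hj m
    have h : dualRes P inf_le_left (sf' i) = dualRes P inf_le_right (sf' j) := hsf i j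
    exact congrArg (fun f : dualSections P (U i ⊓ U j) => f.1 ⟨Z, le_inf hi hj⟩ m) h
  have cov : ∀ W : X.Opens, W ≤ iSup U → W ≤ ⨆ i, U i ⊓ W := fun W hW => by
    rw [← iSup_inf_eq]
    exact le_inf hW le_rfl
  have glue : ∀ (W : {V : X.Opens // V ≤ iSup U}) (m : P.presheaf.obj (op W.1)), ∃ s : Γ(X, W.1),
      ∀ i, resO inf_le_right s =
        (sf' i).1 ⟨U i ⊓ W.1, inf_le_left⟩ (pres P inf_le_right m) := by
    intro W m
    obtain ⟨s, hs, -⟩ := X.sheaf.existsUnique_gluing' (fun i => U i ⊓ W.1) W.1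
      (fun i => homOfLE inf_le_right) (cov _ W.2)
      (fun i => (sf' i).1 ⟨U i ⊓ W.1, inf_le_left⟩ (pres P inf_le_right m)) (by
        intro i j
        refine ((sf' i).2.2 ⟨U i ⊓ W.1, inf_le_left⟩
          ⟨(U i ⊓ W.1) ⊓ (U j ⊓ W.1), inf_le_left.trans inf_le_left⟩ inf_le_left _).symm.trans ?_
        refine Eq.trans ?_ ((sf' j).2.2 ⟨U j ⊓ W.1, inf_le_left⟩
          ⟨(U i ⊓ W.1) ⊓ (U j ⊓ W.1), inf_le_right.trans inf_le_left⟩ inf_le_right _)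
        refine (congrArg _ (pres_pres P _ _ m)).trans ?_
        refine Eq.trans ?_ (congrArg _ (pres_pres P _ _ m)).symm
        exact key _ _ _ _ _ _)
    exact ⟨s, hs⟩
  choose g hg using glue
  have uniq : ∀ (W : {V : X.Opens // V ≤ iSup U}) (m : P.presheaf.obj (op W.1)) (s : Γ(X, W.1)),
      (∀ i, resO inf_le_right s =
        (sf' i).1 ⟨U i ⊓ W.1, inf_le_left⟩ (pres P inf_le_right m)) → s = g W m :=
    fun W m s hs => eq_of_resO_eq (fun i => U i ⊓ W.1) (fun _ => inf_le_right) (cov _ W.2)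
      fun i => (hs i).trans (hg W m i).symm
  let G : dualSections P (iSup U) := ⟨fun W => AddMonoidHom.mk' (g W) (fun a b => by
      refine (uniq W (a + b) _ fun i => ?_).symm
      rw [map_add, hg, hg, map_add, map_add]), by
    refine ⟨fun W r m => ?_, fun W W' h m => ?_⟩
    · refine (uniq W _ _ fun i => ?_).symm
      refine (map_mul _ _ _).trans ?_
      refine (congrArg _ (hg W m i)).trans ?_
      refine ((sf' i).2.1 ⟨U i ⊓ W.1, inf_le_left⟩ _ _).symm.trans ?_
      exact congrArg _ (pres_psmul P _ r m).symm
    · refine (uniq W' _ _ fun i => ?_).symm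
      have h' : U i ⊓ W'.1 ≤ U i ⊓ W.1 := inf_le_inf_left _ h
      refine (resO_resO _ _ _).trans ?_
      refine (resO_resO inf_le_right h' (g W m)).symm.trans ?_
      refine (congrArg (resO h') (hg W m i)).trans ?_
      refine ((sf' i).2.2 ⟨U i ⊓ W.1, inf_le_left⟩ ⟨U i ⊓ W'.1, inf_le_left⟩ h' _).symm.trans ?_
      refine (congrArg _ (pres_pres P inf_le_right h' m)).trans ?_
      exact (congrArg _ (pres_pres P h inf_le_right m)).symm⟩
  refine ⟨G, fun i => ?_, fun G' hG' => ?_⟩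
  · change dualRes P (le_iSup U i) G = sf' i
    refine Subtype.ext (funext fun W => AddMonoidHom.ext fun m => ?_)
    refine (uniq ⟨W.1, W.2.trans (le_iSup U i)⟩ m _ fun j => ?_).symm
    refine ((sf' i).2.2 W ⟨U j ⊓ W.1, inf_le_right.trans W.2⟩ inf_le_right m).symm.trans ?_
    exact key _ _ _ _ _ _
  · let G'' : dualSections P (iSup U) := G'
    change G'' = G
    have hG'' : ∀ i, dualRes P (le_iSup U i) G'' = sf' i := hG'
    refine Subtype.ext (funext fun W => AddMonoidHom.ext fun m => ?_)
    refine uniq W m _ fun i => ?_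
    rw [← hG'' i]
    exact (G''.2.2 W ⟨U i ⊓ W.1, inf_le_right.trans W.2⟩ inf_le_right m).symm

/-- The `O_X`-module `Hom(P, O_X)`. -/
def dual (P : X.PresheafOfModules) : X.Modules where
  val := dualPresheaf P
  isSheaf := dualAb_isSheaf P

/-- The inverse `M⁻¹ = Hom(M, O_X)` of a line bundle `M`. -/
def inverse (M : X.Modules) : X.Modules := dual M.val

/-- The value `m'(m)` of a section `m'` of `M⁻¹` at a section `m` of `M`. -/
def pairing {M : X.Modules} {U : X.Opens} (m' : Γ(inverse M, U)) (m : Γ(M, U)) : Γ(X, U) :=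
  (show dualSections M.val U from m').1 ⟨U, le_rfl⟩ m

/-! ### Divisors -/

/-- The ideal `I_B ⊆ O_X` of a closed subscheme `i : B ⟶ X`, `I_B(U) = ker (O_X(U) → O_B(i⁻¹U))`. -/
def idealModule {B : Scheme.{0}} (i : B ⟶ X) : X.PresheafOfModules :=
  PresheafOfModules.Submodule.toPresheafOfModules
    (M := PresheafOfModules.unit X.ringCatSheaf.obj)
    { obj := fun U => (RingHom.ker (i.app U.unop).hom : Ideal Γ(X, U.unop))
      map := fun {U V} f r (hr : (i.app U.unop).hom r = 0) => by
        change (i.app V.unop).hom ((X.presheaf.map f).hom r) = 0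
        have h := congrArg (fun t => t.hom r) (i.naturality f)
        refine h.trans ?_
        exact (congrArg _ hr).trans
          (map_zero (B.presheaf.map ((Opens.map i.base).map f.unop).op).hom) }

/-- The line bundle `O_X(B) = Hom(I_B, O_X)` of an effective Cartier divisor `i : B ⟶ X`. -/
def divisorModule {B : Scheme.{0}} (i : B ⟶ X) : X.Modules := dual (idealModule i)

/-- The canonical section of `O_X(B)`, given by the inclusion `I_B ⊆ O_X`. -/
def canonicalSection {B : Scheme.{0}} (i : B ⟶ X) : Γ(divisorModule i, ⊤) :=
  show dualSections (idealModule i) ⊤ from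
    ⟨fun V => AddMonoidHom.mk' (fun r => (show RingHom.ker (i.app V.1).hom from r).1)
      (fun _ _ => rfl), fun _ _ _ => rfl, fun _ _ _ _ => rfl⟩

/-- `i : B ⟶ X` is (the inclusion of) an effective Cartier divisor: a closed subscheme whose ideal
is locally generated by one nonzerodivisor. -/
def IsEffectiveCartierDivisor {B : Scheme.{0}} (i : B ⟶ X) : Prop :=
  IsClosedImmersion i ∧ ∀ x : X, ∃ (U : X.Opens) (f : Γ(X, U)), x ∈ U ∧ IsAffineOpen U ∧
    f ∈ nonZeroDivisors Γ(X, U) ∧ RingHom.ker (i.app U).hom = Ideal.span {f}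

/-- A smooth divisor of a complex variety `p : X ⟶ Spec ℂ`. -/
def IsSmoothDivisor (p : X ⟶ Spec (.of ℂ)) {B : Scheme.{0}} (i : B ⟶ X) : Prop :=
  IsEffectiveCartierDivisor i ∧ Smooth (i ≫ p)

/-! ### Double covers -/

/-- Let `φ : O_X(B) ≅ M ⊗ M` and let `σ` be the section of `M ⊗ M` corresponding to the canonical
section of `O_X(B)`. The double cover branched along `B` defined by `M` (and `φ`) is the relative
spectrum `π : Y ⟶ X` of the `O_X`-algebra `O_X ⊕ M⁻¹`, whose multiplication is given on
`M⁻¹ ⊗ M⁻¹ = (M ⊗ M)⁻¹` by evaluation at `σ`. That is, `π` is affine and there is an `O_X`-linear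
map `ι : M⁻¹ ⟶ π_* O_Y` such that `(π^♯, ι) : O_X ⊕ M⁻¹ ⟶ π_* O_Y` is an isomorphism and
`ι(m) ι(m') = π^♯ ⟨m ⊗ m', σ⟩`. If `e` is a frame of `M` and `σ = c • (e ⊗ e)`, then
`⟨m ⊗ m', σ⟩ = c * m(e) * m'(e)`. -/
def IsDoubleCover {B : Scheme.{0}} (i : B ⟶ X) {M : X.Modules}
    (φ : divisorModule i ≅ tensor M M) {Y : Scheme.{0}} (π : Y ⟶ X) : Prop :=
  IsAffineHom π ∧
  ∃ ι : inverse M ⟶ (Scheme.Modules.pushforward π).obj (structureModule Y),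
    (∀ U : X.Opens, Function.Bijective fun a : Γ(X, U) × Γ(inverse M, U) =>
      (π.app U).hom a.1 + (show Γ(Y, π ⁻¹ᵁ U) from (ι.app U).hom a.2)) ∧
    ∀ (U : X.Opens) (e : Γ(M, U)) (c : Γ(X, U)), IsFrame e →
      res le_top ((φ.hom.app ⊤).hom (canonicalSection i)) = c • tmul e e →
      ∀ m m' : Γ(inverse M, U),
        (show Γ(Y, π ⁻¹ᵁ U) from (ι.app U).hom m) * (show Γ(Y, π ⁻¹ᵁ U) from (ι.app U).hom m') =
          (π.app U).hom (c * pairing m e * pairing m' e)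

/-! ### Projective space and very ample line bundles -/

/-- The grading of `ℂ[x₀, …, x_N]` by degree. -/
abbrev grading (N : ℕ) : ℕ → Submodule ℂ (MvPolynomial (Fin (N + 1)) ℂ) :=
  MvPolynomial.homogeneousSubmodule (Fin (N + 1)) ℂ

instance (N : ℕ) : GradedAlgebra (grading N) := MvPolynomial.gradedAlgebra

/-- Complex projective space of dimension `N`. -/
abbrev projectiveSpace (N : ℕ) : Scheme.{0} := Proj (grading N)

/-- The structure morphism of projective space. -/
def projectiveSpace.toSpec (N : ℕ) : projectiveSpace N ⟶ Spec (.of ℂ) :=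
  Proj.toSpecZero (grading N) ≫ Spec.map (CommRingCat.ofHom (algebraMap ℂ (grading N 0)))

/-- The standard open set `x_k ≠ 0`. -/
abbrev chart {N : ℕ} (k : Fin (N + 1)) : (projectiveSpace N).Opens :=
  Proj.basicOpen (grading N) (MvPolynomial.X k)

/-- The function `x_l / x_k` on the open set `x_k ≠ 0`. -/
def coordRatio {N : ℕ} (k l : Fin (N + 1)) : Γ(projectiveSpace N, chart k) :=
  (Proj.awayToSection (grading N) (MvPolynomial.X k)).hom
    (HomogeneousLocalization.Away.mk (grading N) (f := MvPolynomial.X k) (d := 1)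
      (MvPolynomial.isHomogeneous_X ℂ k) 1 (MvPolynomial.X l)
      (by simpa using MvPolynomial.isHomogeneous_X ℂ l))

/-- `f : X ⟶ ℙ^N` is the morphism `x ↦ [s₀(x) : … : s_N(x)]` given by global sections
`s₀, …, s_N` of `H`: over the preimage of `x_k ≠ 0`, the section `s_k` is a frame of `H` and
`s_l = f^♯(x_l / x_k) • s_k`. -/
def IsGivenBySections {N : ℕ} (f : X ⟶ projectiveSpace N) (H : X.Modules)
    (s : Fin (N + 1) → Γ(H, ⊤)) : Prop :=
  ∀ k : Fin (N + 1),
    IsFrame (res (V := f ⁻¹ᵁ chart k) le_top (s k)) ∧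
    ∀ l : Fin (N + 1), res (V := f ⁻¹ᵁ chart k) le_top (s l) =
      (f.app (chart k)).hom (coordRatio k l) • res (V := f ⁻¹ᵁ chart k) le_top (s k)

/-- `X` is projective over `ℂ`. -/
def IsProjective (p : X ⟶ Spec (.of ℂ)) : Prop :=
  ∃ (N : ℕ) (f : X ⟶ projectiveSpace N), IsClosedImmersion f ∧ f ≫ projectiveSpace.toSpec N = p

/-- `H` is a very ample line bundle on the projective `ℂ`-scheme `X`: finitely many global sections
of `H` define a closed embedding of `X` into a projective space over `ℂ`. -/
def IsVeryAmple (p : X ⟶ Spec (.of ℂ)) (H : X.Modules) : Prop :=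
  ∃ (N : ℕ) (f : X ⟶ projectiveSpace N) (s : Fin (N + 1) → Γ(H, ⊤)),
    IsClosedImmersion f ∧ f ≫ projectiveSpace.toSpec N = p ∧ IsGivenBySections f H s

end DoubleCover

end

open scoped TensorProduct
open CategoryTheory Opposite TopologicalSpace AlgebraicGeometry

noncomputable section

namespace DoubleCover

section

variable {X : Scheme.{0}}

/-! ### Sections of modules: restriction, gluing, morphisms -/

section Sections

variable {M N : X.Modules} {U V W : X.Opens}

/-! Write N = M⁻¹. Since π_*O_Y = O_X ⊕ N via π^♯ and ι, a section of π^*H is locally (u + ι(m)) •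
π^*e with e a frame of H, and the tensor e ⊗ m does not depend on e. Global sections of π^*H are
thus pairs of a section of H and a section of H ⊗ N; `exists_pullback_section` and
`exists_tensor_section` are the inclusion and the projection for the second component.

Suppose H ⊗ N is globally generated. Finitely many generators v_j suffice by compactness. Let s_k be
sections embedding X by f, and let t_j be the section of π^*H obtained from v_j. The π^*s_k and the
t_j together define g : Y ⟶ ℙ. The coordinates π^*s_k recover f ∘ π, hence π. Where v_j = e ⊗ ε with
ε a frame of N, the ratio of t_j to some π^*s_k recovers w = ι(ε) up to a function from X, and 1, w
generate O_Y over O_X. So g is a monomorphism (`mono_of_sections`). It is proper because π is finite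
and X is proper, and a proper monomorphism is a closed immersion.

Conversely, let sections τ_l embed Y by g, with second components v_l, and suppose all v_l vanish at
x. On the fibre over x every τ_l is then a scalar of κ(x) times π^*e, so g cannot separate points of
the fibre. But the fibre is the spectrum of a 2-dimensional κ(x)-algebra and has two distinct points
over the same κ(x)-algebra R (`exists_ringHom_pair`), which contradicts that g is a monomorphism
(`exists_mem_basicOpen_of_mono`).

Everything is computed in frames. The inputs are that frames pull back to frames
(`IsFrame.pullbackSection`), that global generation means that some section is a frame near each
point, and the description of maps to ℙ^N by coordinate ratios (`projective_hom_ext`,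
`exists_isGivenBySections`). -/

lemma res_res (h : V ≤ U) (h' : W ≤ V) (m : Γ(M, U)) :
    res h' (res h m) = res (h'.trans h) m :=
  pres_pres M.val h h' m

lemma res_self (m : Γ(M, U)) : res (le_refl U) m = m := by
  simp [res]

lemma res_smul (h : V ≤ U) (r : Γ(X, U)) (m : Γ(M, U)) :
    res h (r • m) = resO h r • res h m :=
  M.map_smul (homOfLE h) r m

lemma app_smul (f : M ⟶ N) (r : Γ(X, U)) (m : Γ(M, U)) :
    (f.app U).hom (r • m) = r • (f.app U).hom m :=
  f.app_smul r m

lemma app_res (f : M ⟶ N) (h : V ≤ U) (m : Γ(M, U)) :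
    (f.app V).hom (res h m) = res h ((f.app U).hom m) :=
  congrArg (fun t => t.hom m) (f.mapPresheaf.naturality (homOfLE h).op)

lemma hom_app_resO {Y : Scheme.{0}} (π : Y ⟶ X) (h : V ≤ U) (r : Γ(X, U)) :
    (π.app V).hom (resO h r) = resO (U := π ⁻¹ᵁ U) (V := π ⁻¹ᵁ V) (fun _ hx => h hx)
      ((π.app U).hom r) :=
  congrArg (fun t => t.hom r) (π.naturality (homOfLE h).op)

lemma eq_of_res_eq {ι : Type*} (U : ι → X.Opens) (hU : ∀ i, U i ≤ V)
    (hV : V ≤ iSup U) {s t : Γ(M, V)} (h : ∀ i, res (hU i) s = res (hU i) t) : s = t :=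
  TopCat.Sheaf.eq_of_locally_eq' ⟨M.presheaf, M.isSheaf⟩ U V (fun i => homOfLE (hU i)) hV s t h

lemma eq_of_res_eq_nhds {s t : Γ(M, V)}
    (h : ∀ x ∈ V, ∃ (W : X.Opens) (hW : W ≤ V), x ∈ W ∧ res hW s = res hW t) : s = t := by
  choose W hW hx e using h
  exact eq_of_res_eq (fun x : V => W x.1 x.2) (fun x => hW x.1 x.2)
    (fun x hxV => Opens.mem_iSup.2 ⟨⟨x, hxV⟩, hx x hxV⟩) (fun x => e x.1 x.2)

/-- Agreement is only required on some cover of each overlap, so that an overlap may be presented in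
another form, for instance as π⁻¹(U ⊓ U'). -/
lemma exists_glue {ι : Type} (U : ι → X.Opens) (hU : ∀ i, U i ≤ V) (hV : V ≤ iSup U)
    (s : ∀ i, Γ(M, U i))
    (h : ∀ i j, ∃ (κ : Type) (W : κ → X.Opens) (hi : ∀ k, W k ≤ U i) (hj : ∀ k, W k ≤ U j),
      U i ⊓ U j ≤ iSup W ∧ ∀ k, res (hi k) (s i) = res (hj k) (s j)) :
    ∃ t : Γ(M, V), ∀ i, res (hU i) t = s i := by
  obtain ⟨t, ht, -⟩ := TopCat.Sheaf.existsUnique_gluing' ⟨M.presheaf, M.isSheaf⟩ U V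
    (fun i => homOfLE (hU i)) hV s (by
      intro i j
      obtain ⟨κ, W, hi, hj, hW, e⟩ := h i j
      change res inf_le_left (s i) = res inf_le_right (s j)
      refine eq_of_res_eq W (fun k => le_inf (hi k) (hj k)) hW fun k => ?_
      rw [res_res, res_res]
      exact e k)
  exact ⟨t, ht⟩

lemma exists_glueO {ι : Type} (U : ι → X.Opens) (hU : ∀ i, U i ≤ V) (hV : V ≤ iSup U)
    (s : ∀ i, Γ(X, U i))
    (h : ∀ i j, resO (inf_le_left : U i ⊓ U j ≤ U i) (s i) = resO inf_le_right (s j)) :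
    ∃ t : Γ(X, V), ∀ i, resO (hU i) t = s i := by
  obtain ⟨t, ht, -⟩ := X.sheaf.existsUnique_gluing' U V (fun i => homOfLE (hU i)) hV s h
  exact ⟨t, ht⟩

/-- A morphism of `O_X`-modules from compatible linear maps on sections. -/
def mkHom (f : ∀ U : X.Opens, Γ(M, U) →+ Γ(N, U))
    (hs : ∀ (U : X.Opens) (r : Γ(X, U)) (m : Γ(M, U)), f U (r • m) = r • f U m)
    (hr : ∀ (U V : X.Opens) (h : V ≤ U) (m : Γ(M, U)), f V (res h m) = res h (f U m)) : M ⟶ N :=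
  SheafOfModules.Hom.mk (PresheafOfModules.homMk (M₁ := M.val) (M₂ := N.val)
    { app := fun U => AddCommGrpCat.ofHom (f U.unop)
      naturality := fun U V i => by
        ext m
        exact hr _ _ i.unop.le m }
    (fun U r m => hs U.unop r m))

lemma hom_ext_sections {f g : M ⟶ N} (h : ∀ U (m : Γ(M, U)), (f.app U).hom m = (g.app U).hom m) :
    f = g := by
  ext U m
  exact h U m

end Sections

/-! ### Frames of line bundles -/

section Frames

variable {M : X.Modules} {U V W : X.Opens} {e : Γ(M, U)}

lemma IsFrame.res (he : IsFrame e) (h : V ≤ U) : IsFrame (res h e) := fun W hW => by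
  simpa only [res_res] using he W (hW.trans h)

lemma IsFrame.exists_smul (he : IsFrame e) (m : Γ(M, U)) : ∃ r : Γ(X, U), m = r • e := by
  obtain ⟨r, hr⟩ := (he U le_rfl).2 m
  exact ⟨r, by simpa only [res_self] using hr.symm⟩

lemma IsFrame.smul_inj (he : IsFrame e) {r s : Γ(X, U)} (h : r • e = s • e) : r = s :=
  (he U le_rfl).1 (by simpa only [res_self] using h)

lemma IsFrame.isUnit_of_smul (he : IsFrame e) {a : Γ(X, U)} (h : IsFrame (a • e)) : IsUnit a := by
  obtain ⟨b, hb⟩ := h.exists_smul e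
  refine IsUnit.of_mul_eq_one b (he.smul_inj ?_)
  rw [mul_comm, mul_smul, ← hb, one_smul]

lemma IsFrame.smul_of_isUnit (he : IsFrame e) {a : Γ(X, U)} (h : IsUnit a) : IsFrame (a • e) := by
  intro V hV
  have hu : IsUnit (resO hV a) := h.map _
  have : (fun r : Γ(X, V) => r • DoubleCover.res hV (a • e)) =
      (fun r : Γ(X, V) => r • DoubleCover.res hV e) ∘ fun r => r * resO hV a := by
    funext r
    simp only [res_smul, Function.comp, mul_smul]
  rw [this]
  exact (he V hV).comp (hu.unit.mulRight_bijective)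

/-- Coefficients with respect to `e` exist locally, and their uniqueness makes them glue. -/
lemma isFrame_of_nhds (h : ∀ x ∈ U, ∃ (W : X.Opens) (hW : W ≤ U), x ∈ W ∧ IsFrame (res hW e)) :
    IsFrame e := by
  choose W hW hx he using h
  intro V hV
  have hc : V ≤ ⨆ x : U, W x.1 x.2 ⊓ V := fun x hxV =>
    Opens.mem_iSup.2 ⟨⟨x, hV hxV⟩, hx x (hV hxV), hxV⟩
  constructor
  · intro r s hrs
    refine eq_of_resO_eq (fun x : U => W x.1 x.2 ⊓ V) (fun _ => inf_le_right) hc fun x => ?_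
    have := congrArg (DoubleCover.res (inf_le_right : W x.1 x.2 ⊓ V ≤ V)) hrs
    simp only [res_smul, res_res] at this
    refine ((he x.1 x.2).res (inf_le_left : W x.1 x.2 ⊓ V ≤ _)).smul_inj ?_
    simpa only [res_res] using this
  · intro m
    have hf := fun x : U => (he x.1 x.2).res (inf_le_left : W x.1 x.2 ⊓ V ≤ _)
    choose r hr using fun x : U => (hf x).exists_smul (DoubleCover.res inf_le_right m)
    obtain ⟨t, ht⟩ := exists_glueO (V := V) (fun x : U => W x.1 x.2 ⊓ V) (fun _ => inf_le_right) hc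
      r (fun x y => by
        refine ((hf x).res (inf_le_left : _ ⊓ (W y.1 y.2 ⊓ V) ≤ _)).smul_inj ?_
        have h1 := congrArg (DoubleCover.res
          (inf_le_left : (W x.1 x.2 ⊓ V) ⊓ (W y.1 y.2 ⊓ V) ≤ _)) (hr x)
        have h2 := congrArg (DoubleCover.res
          (inf_le_right : (W x.1 x.2 ⊓ V) ⊓ (W y.1 y.2 ⊓ V) ≤ _)) (hr y)
        simp only [res_smul, res_res] at h1 h2 ⊢
        exact h1.symm.trans h2)
    refine ⟨t, eq_of_res_eq (fun x : U => W x.1 x.2 ⊓ V) (fun _ => inf_le_right) hc fun x => ?_⟩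
    simp only [res_smul, res_res, ht]
    rw [hr x]
    simp only [res_res]

end Frames

end

/-! ### Pullback of modules and of frames -/

section

variable {X Y : Scheme.{0}}

section Pullback

variable (π : Y ⟶ X) {M : X.Modules} {U V : X.Opens}

/-- The pullback of a section of `M` to a section of `π^* M`. -/
def pullbackSection (m : Γ(M, U)) : Γ((Scheme.Modules.pullback π).obj M, π ⁻¹ᵁ U) :=
  (((Scheme.Modules.pullbackPushforwardAdjunction π).unit.app M).app U).hom m

lemma preimage_le_preimage (h : V ≤ U) : π ⁻¹ᵁ V ≤ π ⁻¹ᵁ U := fun _ hx => h hx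

lemma pullbackSection_smul (r : Γ(X, U)) (m : Γ(M, U)) :
    pullbackSection π (r • m) = (π.app U).hom r • pullbackSection π m :=
  app_smul ((Scheme.Modules.pullbackPushforwardAdjunction π).unit.app M) r m

lemma pullbackSection_res (h : V ≤ U) (m : Γ(M, U)) :
    pullbackSection π (res h m) = res (preimage_le_preimage π h) (pullbackSection π m) :=
  app_res ((Scheme.Modules.pullbackPushforwardAdjunction π).unit.app M) h m

/-- The pullback is accessible only through the adjunction with π_*; this is injectivity of
transposition, read on sections. -/
lemma pullback_hom_ext {N : Y.Modules} {f g : (Scheme.Modules.pullback π).obj M ⟶ N}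
    (h : ∀ (U : X.Opens) (m : Γ(M, U)),
      (f.app _).hom (pullbackSection π m) = (g.app _).hom (pullbackSection π m)) : f = g := by
  apply ((Scheme.Modules.pullbackPushforwardAdjunction π).homEquiv M N).injective
  rw [Adjunction.homEquiv_unit, Adjunction.homEquiv_unit]
  exact hom_ext_sections h

lemma exists_pullback_hom {N : Y.Modules} (k : M ⟶ (Scheme.Modules.pushforward π).obj N) :
    ∃ f : (Scheme.Modules.pullback π).obj M ⟶ N, ∀ (U : X.Opens) (m : Γ(M, U)),
      (f.app (π ⁻¹ᵁ U)).hom (pullbackSection π m) = (k.app U).hom m := by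
  refine ⟨((Scheme.Modules.pullbackPushforwardAdjunction π).homEquiv M N).symm k, fun U m => ?_⟩
  have h := ((Scheme.Modules.pullbackPushforwardAdjunction π).homEquiv M N).apply_symm_apply k
  rw [Adjunction.homEquiv_unit] at h
  conv_rhs => rw [← h]
  rfl

end Pullback

section Extension

/-- The sheaf `j_* (N|_V)` for the inclusion `j : V ⟶ Y` of an open subset. -/
def cutoff (V : Y.Opens) (N : Y.Modules) : Y.Modules :=
  (Scheme.Modules.pushforward V.ι).obj ((Scheme.Modules.restrictFunctor V.ι).obj N)

/-- The open subset over which sections of `cutoff V N` over `W` live. -/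
def cutOpen (V W : Y.Opens) : Y.Opens := V.ι ''ᵁ (V.ι ⁻¹ᵁ W)

variable {V W W' : Y.Opens} {N : Y.Modules}

lemma cutOpen_eq : cutOpen V W = V ⊓ W := by
  rw [cutOpen, Scheme.Hom.image_preimage_eq_opensRange_inf, Scheme.Opens.opensRange_ι]

lemma cutOpen_le_left : cutOpen V W ≤ V := cutOpen_eq.le.trans inf_le_left

lemma cutOpen_le_right : cutOpen V W ≤ W := cutOpen_eq.le.trans inf_le_right

lemma cutOpen_mono (h : W' ≤ W) : cutOpen V W' ≤ cutOpen V W := by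
  rw [cutOpen_eq, cutOpen_eq]
  exact inf_le_inf_left _ h

/-- Sections of `cutoff V N` over `W` are sections of `N` over `V ∩ W`. -/
def cutEquiv : Γ(cutoff V N, W) ≃+ Γ(N, cutOpen V W) := AddEquiv.refl _

lemma cutEquiv_smul (r : Γ(Y, W)) (n : Γ(cutoff V N, W)) :
    cutEquiv (r • n) = resO (cutOpen_le_right (V := V)) r • cutEquiv n := by
  have h : (V.ι.appIso (V.ι ⁻¹ᵁ W)).inv.hom ((V.ι.app W).hom r) =
      resO (cutOpen_le_right (V := V)) r :=
    congrArg (fun t => t.hom r) (V.ι.app_appIso_inv W)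
  rw [← h]
  rfl

lemma cutEquiv_res (h : W' ≤ W) (n : Γ(cutoff V N, W)) :
    cutEquiv (res h n) = res (cutOpen_mono h) (cutEquiv n) := rfl

/-- Sections of `cutoff V O` over `W` are functions on `V ∩ W`. -/
def cutFn : Γ(cutoff V (structureModule Y), W) ≃+ Γ(Y, cutOpen V W) := AddEquiv.refl _

lemma cutFn_smul (r : Γ(Y, W)) (n : Γ(cutoff V (structureModule Y), W)) :
    cutFn (r • n) = resO (cutOpen_le_right (V := V)) r * cutFn n :=
  cutEquiv_smul r n

lemma cutFn_res (h : W' ≤ W) (n : Γ(cutoff V (structureModule Y), W)) :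
    cutFn (res h n) = resO (cutOpen_mono h) (cutFn n) := rfl

/-- Restriction of sections to an open subset `V`, as a morphism `N ⟶ j_* (N|_V)`. -/
def toCutoff (V : Y.Opens) (N : Y.Modules) : N ⟶ cutoff V N :=
  mkHom (fun W => (cutEquiv.symm.toAddMonoidHom).comp (res cutOpen_le_right))
    (fun W r m => by
      apply cutEquiv.injective
      rw [cutEquiv_smul]
      exact res_smul _ _ _)
    (fun W W' h m => by
      apply cutEquiv.injective
      rw [cutEquiv_res]
      exact (res_res h _ m).trans (res_res _ (cutOpen_mono h) m).symm)

lemma toCutoff_app (n : Γ(N, W)) :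
    cutEquiv (((toCutoff V N).app W).hom n) = res cutOpen_le_right n := rfl

/-- The morphism `j_* O_V ⟶ j_* (N|_V)` given by a section of `N` over `V`. -/
def cutoffSMul (n : Γ(N, V)) : cutoff V (structureModule Y) ⟶ cutoff V N :=
  mkHom (fun W => AddMonoidHom.mk' (fun r => cutEquiv.symm (cutFn r • res cutOpen_le_left n))
      (fun r s => by rw [map_add, add_smul, map_add]))
    (fun W r m => by
      apply cutEquiv.injective
      rw [cutEquiv_smul]
      simp only [AddMonoidHom.mk'_apply, AddEquiv.apply_symm_apply]
      rw [cutFn_smul, mul_smul])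
    (fun W W' h m => by
      apply cutEquiv.injective
      rw [cutEquiv_res]
      simp only [AddMonoidHom.mk'_apply, AddEquiv.apply_symm_apply]
      rw [res_smul, res_res, cutFn_res])

lemma cutoffSMul_app (n : Γ(N, V)) (r : Γ(cutoff V (structureModule Y), W)) :
    cutEquiv (((cutoffSMul n).app W).hom r) = cutFn r • res cutOpen_le_left n := rfl

end Extension

variable (π : Y ⟶ X) {M : X.Modules} {U V : X.Opens}

lemma cutOpen_preimage_le : cutOpen (π ⁻¹ᵁ U) (π ⁻¹ᵁ V) ≤ π ⁻¹ᵁ (U ⊓ V) := cutOpen_eq.le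

/-- The coefficient with respect to `e` is defined only over U, whereas the adjunction needs a
morphism out of all of M. Hence the target j_*O of π⁻¹U: a section of M over W is sent to π^♯ of its
coefficient over U ⊓ W, and this map is transposed. -/
lemma exists_pullback_coeff {e : Γ(M, U)} (he : IsFrame e) :
    ∃ f : (Scheme.Modules.pullback π).obj M ⟶ cutoff (π ⁻¹ᵁ U) (structureModule Y),
      ∀ (W : X.Opens) (m : Γ(M, W)) (r : Γ(X, U ⊓ W)),
        res inf_le_right m = r • res inf_le_left e →
        cutFn ((f.app (π ⁻¹ᵁ W)).hom (pullbackSection π m)) =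
          resO (cutOpen_preimage_le π) ((π.app (U ⊓ W)).hom r) := by
  choose c hc using fun (W : X.Opens) (m : Γ(M, W)) =>
    (he.res (inf_le_left : U ⊓ W ≤ U)).exists_smul (res inf_le_right m)
  have huniq : ∀ (W : X.Opens) (m : Γ(M, W)) (r : Γ(X, U ⊓ W)),
      res inf_le_right m = r • res inf_le_left e → r = c W m := fun W m r h =>
    (he.res (inf_le_left : U ⊓ W ≤ U)).smul_inj (h.symm.trans (hc W m))
  let G : ∀ W : X.Opens, Γ(X, U ⊓ W) →+* Γ(Y, cutOpen (π ⁻¹ᵁ U) (π ⁻¹ᵁ W)) := fun W =>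
    (resO (cutOpen_preimage_le π)).comp (π.app (U ⊓ W)).hom
  let F : ∀ W : X.Opens, Γ(M, W) →+ Γ(cutoff (π ⁻¹ᵁ U) (structureModule Y), π ⁻¹ᵁ W) := fun W =>
    AddMonoidHom.mk' (fun m => cutFn.symm (G W (c W m)))
      (fun m m' => by
        rw [← huniq W (m + m') (c W m + c W m') (by rw [map_add, add_smul, ← hc, ← hc]),
          map_add, map_add])
  have hF : ∀ W m, cutFn (F W m) = G W (c W m) := fun W m => rfl
  have hFs : ∀ (W : X.Opens) (r : Γ(X, W)) (m : Γ(M, W)),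
      F W (r • m) = (π.app W).hom r • F W m := fun W r m => by
    apply cutFn.injective
    rw [cutFn_smul, hF, hF, ← huniq W (r • m) (resO inf_le_right r * c W m)
      (by rw [res_smul, mul_smul, ← hc]), map_mul]
    congr 1
    exact (congrArg _ (hom_app_resO π _ r)).trans (resO_resO _ _ _)
  have hFr : ∀ (W W' : X.Opens) (h : W' ≤ W) (m : Γ(M, W)),
      F W' (res h m) = res (preimage_le_preimage π h) (F W m) := fun W W' h m => by
    apply cutFn.injective
    rw [cutFn_res, hF, hF, ← huniq W' (res h m) (resO (inf_le_inf_left _ h) (c W m))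
      (by
        have := congrArg (res (inf_le_inf_left U h : U ⊓ W' ≤ U ⊓ W)) (hc W m)
        simpa only [res_res, res_smul] using this)]
    exact ((congrArg _ (hom_app_resO π _ _)).trans (resO_resO _ _ _)).trans
      (resO_resO _ _ _).symm
  obtain ⟨f, hf⟩ := exists_pullback_hom π
    (mkHom (N := (Scheme.Modules.pushforward π).obj (cutoff (π ⁻¹ᵁ U) (structureModule Y)))
      F hFs hFr)
  refine ⟨f, fun W m r hr => ?_⟩
  rw [hf, huniq W m r hr]
  exact hF W m

/-- The coefficient map f sends π^*e to 1, which gives injectivity of r ↦ r • π^*e. Following f by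
multiplication with π^*e is the restriction map to π⁻¹U, as can be checked on pulled-back sections;
this gives surjectivity. -/
lemma IsFrame.pullbackSection {e : Γ(M, U)} (he : IsFrame e) :
    IsFrame (pullbackSection π e) := by
  obtain ⟨f, hf⟩ := exists_pullback_coeff π he
  have key : f ≫ cutoffSMul (DoubleCover.pullbackSection π e) =
      toCutoff (π ⁻¹ᵁ U) ((Scheme.Modules.pullback π).obj M) := by
    refine pullback_hom_ext π fun W m => ?_
    obtain ⟨r, hr⟩ := (he.res (inf_le_left : U ⊓ W ≤ U)).exists_smul
      (DoubleCover.res inf_le_right m)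
    apply cutEquiv.injective
    refine (cutoffSMul_app _ _).trans (Eq.trans ?_ (toCutoff_app _).symm)
    refine (congrArg (· • DoubleCover.res cutOpen_le_left _) (hf W m r hr)).trans ?_
    have h1 := congrArg (DoubleCover.pullbackSection π) hr
    rw [pullbackSection_smul, pullbackSection_res, pullbackSection_res] at h1
    have h2 := congrArg (DoubleCover.res (cutOpen_preimage_le π)) h1
    rw [res_smul, res_res, res_res] at h2
    exact h2.symm
  intro W hW
  have hWle : W ≤ cutOpen (π ⁻¹ᵁ U) W := by
    rw [cutOpen_eq]
    exact le_inf hW le_rfl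
  have hfW : cutFn ((f.app W).hom (DoubleCover.res hW (DoubleCover.pullbackSection π e))) = 1 := by
    rw [app_res, cutFn_res, hf U e 1 (by rw [one_smul]), map_one, map_one, map_one]
  constructor
  · intro r s hrs
    have h : ∀ t : Γ(Y, W), cutFn ((f.app W).hom
        (t • DoubleCover.res hW (DoubleCover.pullbackSection π e))) =
        resO cutOpen_le_right t := fun t => by
      rw [app_smul, cutFn_smul, hfW, mul_one]
    have h' : resO (cutOpen_le_right : cutOpen (π ⁻¹ᵁ U) W ≤ W) r = resO cutOpen_le_right s :=
      (h r).symm.trans ((congrArg (fun t => cutFn ((f.app W).hom t)) hrs).trans (h s))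
    have h'' := congrArg (resO hWle) h'
    rwa [resO_resO, resO_resO, resO_self, resO_self] at h''
  · intro p
    have h : cutEquiv (((cutoffSMul (DoubleCover.pullbackSection π e)).app W).hom
        ((f.app W).hom p)) = DoubleCover.res cutOpen_le_right p :=
      congrArg (fun g => cutEquiv ((g.app W).hom p)) key
    rw [cutoffSMul_app] at h
    have h' := congrArg (DoubleCover.res hWle) h
    rw [res_smul, res_res, res_res, res_self] at h'
    exact ⟨_, h'⟩

end

/-! ### Tensor products and duals -/

section

variable {X : Scheme.{0}} {M N : X.Modules} {U V W : X.Opens}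

/-- The canonical map `M(U) ⊗ N(U) → (M ⊗ N)(U)`. -/
def tensorToSections (M N : X.Modules) (U : X.Opens) :
    Γ(M, U) ⊗[Γ(X, U)] Γ(N, U) →ₗ[Γ(X, U)] Γ(tensor M N, U) where
  toFun z := ((PresheafOfModules.sheafificationAdjunction (𝟙 X.ringCatSheaf.obj)).unit.app
    (tensorPresheaf M N)).app (op U) (show ((tensorPresheaf M N).obj (op U) : Type) from z)
  map_add' _ _ := map_add (((PresheafOfModules.sheafificationAdjunction
    (𝟙 X.ringCatSheaf.obj)).unit.app (tensorPresheaf M N)).app (op U)).hom _ _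
  map_smul' r z := (((PresheafOfModules.sheafificationAdjunction
    (𝟙 X.ringCatSheaf.obj)).unit.app (tensorPresheaf M N)).app (op U)).hom.map_smul
      (show X.ringCatSheaf.obj.obj (op U) from r)
      (show ((tensorPresheaf M N).obj (op U) : Type) from z)

lemma tensorToSections_tmul (m : Γ(M, U)) (n : Γ(N, U)) :
    tensorToSections M N U (m ⊗ₜ n) = tmul m n := rfl

lemma smul_tmul (r : Γ(X, U)) (m : Γ(M, U)) (n : Γ(N, U)) : tmul (r • m) n = r • tmul m n := by
  rw [← tensorToSections_tmul, ← TensorProduct.smul_tmul', map_smul, tensorToSections_tmul]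

lemma tmul_smul (r : Γ(X, U)) (m : Γ(M, U)) (n : Γ(N, U)) : tmul m (r • n) = r • tmul m n := by
  rw [← tensorToSections_tmul, TensorProduct.tmul_smul, map_smul, tensorToSections_tmul]

lemma res_tmul (h : V ≤ U) (m : Γ(M, U)) (n : Γ(N, U)) :
    res h (tmul m n) = tmul (res h m) (res h n) := by
  have h1 := PresheafOfModules.naturality_apply ((PresheafOfModules.sheafificationAdjunction
    (𝟙 X.ringCatSheaf.obj)).unit.app (tensorPresheaf M N)) (homOfLE h).op
      (show ((tensorPresheaf M N).obj (op U) : Type) from m ⊗ₜ[Γ(X, U)] n)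
  exact h1.symm

/-- The map from a presheaf to its sheafification is locally surjective; `exists_local_eq` is its
local injectivity. -/
lemma exists_local_lift (t : Γ(tensor M N, U)) (x : X) (hx : x ∈ U) :
    ∃ (W : X.Opens) (h : W ≤ U) (z : Γ(M, W) ⊗[Γ(X, W)] Γ(N, W)), x ∈ W ∧
      tensorToSections M N W z = res h t := by
  have h := Presheaf.imageSieve_mem (Opens.grothendieckTopology X)
    (CategoryTheory.toSheafify (Opens.grothendieckTopology X) (tensorPresheaf M N).presheaf)
    (U := op U) t
  obtain ⟨W, f, ⟨z, hz⟩, hxW⟩ := h x hx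
  exact ⟨W, f.le, z, hxW, hz⟩

lemma exists_local_eq (m m' : Γ(M, U)) (n n' : Γ(N, U)) (h : tmul m n = tmul m' n')
    (x : X) (hx : x ∈ U) :
    ∃ (W : X.Opens) (h : W ≤ U), x ∈ W ∧
      (res h m ⊗ₜ[Γ(X, W)] res h n : Γ(M, W) ⊗[Γ(X, W)] Γ(N, W)) = res h m' ⊗ₜ res h n' := by
  have h := Presheaf.equalizerSieve_mem (Opens.grothendieckTopology X)
    (CategoryTheory.toSheafify (Opens.grothendieckTopology X) (tensorPresheaf M N).presheaf)
    (X := op U) (show (tensorPresheaf M N).presheaf.obj (op U) from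
      (show Γ(M, U) ⊗[Γ(X, U)] Γ(N, U) from m ⊗ₜ[Γ(X, U)] n))
    (show (tensorPresheaf M N).presheaf.obj (op U) from
      (show Γ(M, U) ⊗[Γ(X, U)] Γ(N, U) from m' ⊗ₜ[Γ(X, U)] n')) h
  obtain ⟨W, f, hf, hxW⟩ := h x hx
  exact ⟨W, f.le, hxW, hf⟩

lemma IsFrame.exists_tmul {e : Γ(M, U)} (he : IsFrame e)
    (z : Γ(M, U) ⊗[Γ(X, U)] Γ(N, U)) : ∃ n : Γ(N, U), z = e ⊗ₜ n := by
  induction z with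
  | zero => exact ⟨0, (TensorProduct.tmul_zero _ _).symm⟩
  | tmul m n =>
    obtain ⟨r, rfl⟩ := he.exists_smul m
    exact ⟨r • n, TensorProduct.smul_tmul _ _ _⟩
  | add z w hz hw =>
    obtain ⟨n, rfl⟩ := hz
    obtain ⟨n', rfl⟩ := hw
    exact ⟨n + n', (TensorProduct.tmul_add _ _ _).symm⟩

lemma IsFrame.tmul_inj_local {e : Γ(M, U)} (he : IsFrame e) {n n' : Γ(N, U)}
    (h : (e ⊗ₜ[Γ(X, U)] n : Γ(M, U) ⊗[Γ(X, U)] Γ(N, U)) = e ⊗ₜ n') : n = n' := by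
  have hb : Function.Bijective (LinearMap.toSpanSingleton Γ(X, U) Γ(M, U) e) := by
    constructor
    · intro r s hrs
      exact he.smul_inj hrs
    · intro m
      obtain ⟨r, hr⟩ := he.exists_smul m
      exact ⟨r, hr.symm⟩
  let E := LinearEquiv.ofBijective _ hb
  have hE : E.symm e = 1 := by
    rw [LinearEquiv.symm_apply_eq]
    exact (one_smul _ e).symm
  have := congrArg (fun z => TensorProduct.lid Γ(X, U) Γ(N, U)
    (E.symm.toLinearMap.rTensor Γ(N, U) z)) h
  simpa [hE] using this

lemma IsFrame.tmul_inj {e : Γ(M, U)} (he : IsFrame e) {n n' : Γ(N, U)}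
    (h : tmul e n = tmul e n') : n = n' := by
  refine eq_of_res_eq_nhds fun x hx => ?_
  obtain ⟨W, hW, hxW, hw⟩ := exists_local_eq e e n n' h x hx
  exact ⟨W, hW, hxW, (he.res hW).tmul_inj_local hw⟩

/-- Locally t lifts to a presheaf tensor, which has the form e ⊗ n because e is a frame. By
`IsFrame.tmul_inj` the local n are unique, so they glue. -/
lemma IsFrame.tmul_surj {e : Γ(M, U)} (he : IsFrame e) (t : Γ(tensor M N, U)) :
    ∃ n : Γ(N, U), t = tmul e n := by
  choose W hW z hx hz using fun x : U => exists_local_lift t x.1 x.2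
  choose n hn using fun x : U => (he.res (hW x)).exists_tmul (z x)
  have hn' : ∀ x, DoubleCover.res (hW x) t = tmul (DoubleCover.res (hW x) e) (n x) := fun x => by
    rw [← hz, hn, tensorToSections_tmul]
  have hc : U ≤ iSup W := fun x hxU => Opens.mem_iSup.2 ⟨⟨x, hxU⟩, hx ⟨x, hxU⟩⟩
  obtain ⟨s, hs⟩ := exists_glue (M := N) W hW hc n (fun x y => ⟨Unit, fun _ => W x ⊓ W y,
    fun _ => inf_le_left, fun _ => inf_le_right, le_iSup_of_le () le_rfl, fun _ => by
      refine ((he.res (hW x)).res inf_le_left).tmul_inj ?_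
      rw [← res_tmul, ← hn', res_res, res_res, ← res_res (hW y) inf_le_right,
        ← res_res (hW y) inf_le_right e, ← res_tmul, hn']⟩)
  refine ⟨s, eq_of_res_eq W hW hc fun x => ?_⟩
  rw [hn', res_tmul, hs]

lemma IsFrame.tmul {e : Γ(M, U)} (he : IsFrame e) {f : Γ(N, U)} (hf : IsFrame f) :
    IsFrame (tmul e f) := by
  intro V hV
  rw [res_tmul]
  constructor
  · intro r s hrs
    refine (hf.res hV).smul_inj ((he.res hV).tmul_inj ?_)
    rw [tmul_smul, tmul_smul]
    exact hrs
  · intro t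
    obtain ⟨n, rfl⟩ := (he.res hV).tmul_surj t
    obtain ⟨r, rfl⟩ := (hf.res hV).exists_smul n
    exact ⟨r, (tmul_smul _ _ _).symm⟩

/-- The dual of a frame. -/
lemma IsFrame.exists_dual {e : Γ(M, U)} (he : IsFrame e) :
    ∃ f : Γ(inverse M, U), IsFrame f := by
  choose c hc using fun (W : X.Opens) (h : W ≤ U) (m : Γ(M, W)) => (he.res h).exists_smul m
  have huniq : ∀ (W : X.Opens) (h : W ≤ U) (m : Γ(M, W)) (r : Γ(X, W)),
      m = r • DoubleCover.res h e → c W h m = r := fun W h m r hr =>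
    (he.res h).smul_inj ((hc W h m).symm.trans hr)
  have hadd : ∀ (W : X.Opens) (h : W ≤ U) (m m' : Γ(M, W)),
      c W h (m + m') = c W h m + c W h m' := fun W h m m' => huniq _ _ _ _ (by
    rw [add_smul, ← hc, ← hc])
  have hsmul : ∀ (W : X.Opens) (h : W ≤ U) (r : Γ(X, W)) (m : Γ(M, W)),
      c W h (r • m) = r * c W h m := fun W h r m => huniq _ _ _ _ (by
    rw [mul_smul, ← hc])
  have hres : ∀ (W W' : X.Opens) (h : W ≤ U) (h' : W' ≤ W) (m : Γ(M, W)),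
      c W' (h'.trans h) (DoubleCover.res h' m) = resO h' (c W h m) := fun W W' h h' m =>
    huniq _ _ _ _ (by
      have := congrArg (DoubleCover.res h') (hc W h m)
      rwa [res_smul, res_res] at this)
  let f : dualSections M.val U := ⟨fun W => AddMonoidHom.mk' (c W.1 W.2) (hadd W.1 W.2),
    fun W r m => hsmul W.1 W.2 r m, fun W W' h m => hres W.1 W'.1 W.2 h m⟩
  -- A functional is determined by its value on e: g(m) = g(e) c(m), where c is the coefficient of
  -- m.
  have key : ∀ (V : X.Opens) (hV : V ≤ U) (g : dualSections M.val V) (W : X.Opens)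
      (hW : W ≤ V) (m : Γ(M, W)), g.1 ⟨W, hW⟩ m =
        resO hW (g.1 ⟨V, le_rfl⟩ (DoubleCover.res hV e)) * c W (hW.trans hV) m := fun V hV g W hW m => by
    have h1 := g.2.2 ⟨V, le_rfl⟩ ⟨W, hW⟩ hW (DoubleCover.res hV e)
    have h2 := g.2.1 ⟨W, hW⟩ (c W (hW.trans hV) m) (DoubleCover.res (hW.trans hV) e)
    rw [mul_comm, ← h1]
    have h3 : m = psmul (P := M.val) (c W (hW.trans hV) m) (DoubleCover.res (hW.trans hV) e) := hc _ _ _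
    refine (congrArg _ h3).trans (h2.trans (congrArg _ (congrArg _ ?_)))
    exact (res_res hV hW e).symm
  refine ⟨show Γ(inverse M, U) from f, fun V hV => ⟨fun r s hrs => ?_, fun g => ?_⟩⟩
  · have h : ∀ r : Γ(X, V), (show dualSections M.val V from
        (r • DoubleCover.res hV (show Γ(inverse M, U) from f))).1 ⟨V, le_rfl⟩ (DoubleCover.res hV e) = r := fun r => by
      change resO le_rfl r * c V hV (DoubleCover.res hV e) = r
      rw [huniq V hV _ 1 (one_smul _ _).symm, mul_one, resO_self]
    rw [← h r, ← h s]
    exact congrArg (fun g : dualSections M.val V => g.1 ⟨V, le_rfl⟩ (DoubleCover.res hV e)) hrs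
  · let g' : dualSections M.val V := g
    refine ⟨g'.1 ⟨V, le_rfl⟩ (DoubleCover.res hV e), Subtype.ext (funext fun W => AddMonoidHom.ext fun m => ?_)⟩
    exact (key V hV g' W.1 W.2 m).symm

lemma IsLineBundle.inverse (hM : IsLineBundle M) : IsLineBundle (inverse M) := fun x => by
  obtain ⟨U, e, hx, he⟩ := hM x
  obtain ⟨f, hf⟩ := he.exists_dual
  exact ⟨U, f, hx, hf⟩

end

/-! ### Global generation in terms of frames -/

section

variable {X : Scheme.{0}} {M N : X.Modules}

lemma isFrame_res_basicOpen {U : X.Opens} {e : Γ(M, U)} (he : IsFrame e) (a : Γ(X, U)) :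
    IsFrame (res (X.basicOpen_le a) (a • e)) := by
  rw [res_smul]
  exact (he.res _).smul_of_isUnit (RingedSpace.isUnit_res_basicOpen _ a)

lemma mem_basicOpen_of_isFrame {U V : X.Opens} (h : V ≤ U) {e : Γ(M, U)} (he : IsFrame e)
    (a : Γ(X, U)) (ha : IsFrame (res h (a • e))) : V ≤ X.basicOpen a := by
  rw [res_smul] at ha
  have := (he.res h).isUnit_of_smul ha
  intro x hx
  rw [Scheme.mem_basicOpen X a x (h hx)]
  have h1 := this.map (X.presheaf.germ V x hx).hom
  rwa [TopCat.Presheaf.germ_res_apply] at h1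

lemma free_comp_eq_iff {M Q : SheafOfModules X.ringCatSheaf} {I : Type} (s : I → M.sections)
    (f g : M ⟶ Q) : M.freeHomEquiv.symm s ≫ f = M.freeHomEquiv.symm s ≫ g ↔
      ∀ i, SheafOfModules.sectionsMap f (s i) = SheafOfModules.sectionsMap g (s i) := by
  rw [SheafOfModules.freeHomEquiv_symm_comp, SheafOfModules.freeHomEquiv_symm_comp,
    Q.freeHomEquiv.symm.injective.eq_iff, funext_iff]

/-- The family of restrictions of a global section. -/
def toSections (s : Γ(M, ⊤)) : SheafOfModules.sections (M : SheafOfModules X.ringCatSheaf) :=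
  PresheafOfModules.sectionsMk (M := M.val) (fun U => (res le_top s : Γ(M, U.unop)))
    (fun _ _ f => res_res le_top f.unop.le s)

/-- Near each point every section is a multiple of some s i, so two morphisms out of M that agree on
all s i are equal; this is the required epimorphism property. -/
lemma isGloballyGenerated_of_frames {I : Type} (s : I → Γ(M, ⊤))
    (h : ∀ x : X, ∃ (i : I) (U : X.Opens), x ∈ U ∧ IsFrame (res (le_top : U ≤ ⊤) (s i))) :
    IsGloballyGenerated M := by
  refine ⟨⟨I, fun i => toSections (s i), ⟨fun {Q} f g hfg => ?_⟩⟩⟩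
  have h1 := (free_comp_eq_iff (M := M) _ f g).1 hfg
  let Q' : X.Modules := Q
  let f' : M ⟶ Q' := f
  let g' : M ⟶ Q' := g
  have h2 : ∀ (i : I) (U : X.Opens), (f'.app U).hom (res le_top (s i)) =
      (g'.app U).hom (res le_top (s i)) := fun i U =>
    congrArg (fun t => t.1 (op U)) (h1 i)
  change f' = g'
  refine hom_ext_sections fun V m => eq_of_res_eq_nhds fun x hx => ?_
  obtain ⟨i, U, hxU, hU⟩ := h x
  refine ⟨U ⊓ V, inf_le_right, ⟨hxU, hx⟩, ?_⟩
  obtain ⟨r, hr⟩ := (hU.res (inf_le_left : U ⊓ V ≤ U)).exists_smul (res inf_le_right m)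
  rw [← app_res, ← app_res, hr, app_smul, app_smul, res_res, h2]

/-- If every section of the generating family vanished at x, the unit M ⟶ ψ_*ψ^*M for ψ : Spec κ(x)
⟶ X would kill them all and hence be zero, although it sends a local frame to a frame over a
nonempty scheme. -/
lemma exists_frames_of_isGloballyGenerated (hM : IsLineBundle M) (hg : IsGloballyGenerated M) :
    ∃ (I : Type) (s : I → Γ(M, ⊤)),
      ∀ x : X, ∃ (i : I) (U : X.Opens), x ∈ U ∧ IsFrame (res (le_top : U ≤ ⊤) (s i)) := by
  obtain ⟨⟨I, σ, hepi⟩⟩ := hg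
  let s : I → Γ(M, ⊤) := fun i => (σ i).1 (op ⊤)
  have hs : ∀ (i : I) (U : X.Opens), (σ i).1 (op U) = res le_top (s i) := fun i U =>
    ((σ i).2 (homOfLE (le_top : U ≤ ⊤)).op).symm
  refine ⟨I, s, fun x => ?_⟩
  obtain ⟨U, e, hx, he⟩ := hM x
  choose a ha using fun i => he.exists_smul (res le_top (s i))
  by_cases hax : ∃ i, x ∈ X.basicOpen (a i)
  · obtain ⟨i, hi⟩ := hax
    refine ⟨i, X.basicOpen (a i), hi, ?_⟩
    have := isFrame_res_basicOpen he (a i)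
    rwa [← ha, res_res] at this
  exfalso
  push Not at hax
  let ψ := X.fromSpecResidueField x
  have hψ : ∀ z, ψ z = x := fun z => by
    have := X.range_fromSpecResidueField x
    exact Set.mem_singleton_iff.1 (this ▸ Set.mem_range_self z)
  -- On the spectrum of a field, which is reduced, a function with empty nonvanishing locus is zero.
  have ha0 : ∀ i, (ψ.app U).hom (a i) = 0 := fun i => by
    rw [← AlgebraicGeometry.basicOpen_eq_bot_iff]
    refine (Scheme.preimage_basicOpen ψ (a i)).symm.trans ?_
    refine eq_bot_iff.2 fun z hz => hax i ?_
    rw [← hψ z]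
    exact hz
  let z : Spec (X.residueField x) := default
  have hne : Nonempty (ψ ⁻¹ᵁ U) := ⟨⟨z, by
    change ψ z ∈ U
    rw [hψ]
    exact hx⟩⟩
  have hzero : ∀ i, pullbackSection ψ (s i) = 0 := fun i => by
    refine eq_of_res_eq_nhds fun z _ => ⟨ψ ⁻¹ᵁ U, le_top, ?_, ?_⟩
    · change ψ z ∈ U
      rw [hψ]
      exact hx
    · have h1 := pullbackSection_res ψ (le_top : U ≤ ⊤) (s i)
      rw [ha, pullbackSection_smul, ha0, zero_smul] at h1
      exact h1.symm.trans (map_zero (res _)).symm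
  let u := (Scheme.Modules.pullbackPushforwardAdjunction ψ).unit.app M
  have hu : u = 0 := by
    let u0 : M ⟶ (Scheme.Modules.pushforward ψ).obj ((Scheme.Modules.pullback ψ).obj M) := 0
    refine hepi.left_cancellation u u0 ((free_comp_eq_iff (M := M) σ u u0).2 fun i => ?_)
    refine Subtype.ext (funext fun V => ?_)
    change (u.app V.unop).hom ((σ i).1 (op V.unop)) = 0
    rw [hs, app_res]
    exact (congrArg _ (hzero i)).trans (map_zero (res _))
  have h2 : pullbackSection ψ e = 0 := by
    change (u.app U).hom e = 0
    rw [hu]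
    rfl
  have h3 := (he.pullbackSection ψ).smul_inj (r := 1) (s := 0) (by rw [h2, smul_zero, smul_zero])
  exact one_ne_zero h3

end

/-! ### The coordinate rings of the standard charts -/

section Algebra

lemma eval₂_mul_of_isHomogeneous {σ R S : Type*} [CommSemiring R] [CommSemiring S] (φ : R →+* S)
    (t : S) (f : σ → S) {p : MvPolynomial σ R} {n : ℕ} (hp : p.IsHomogeneous n) :
    p.eval₂ φ (fun l => t * f l) = t ^ n * p.eval₂ φ f := by
  rw [MvPolynomial.eval₂_eq, MvPolynomial.eval₂_eq, Finset.mul_sum]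
  refine Finset.sum_congr rfl fun d hd => ?_
  have h := hp (MvPolynomial.mem_support_iff.1 hd)
  rw [Finsupp.weight_apply] at h
  simp only [Pi.one_apply, smul_eq_mul, mul_one] at h
  rw [← h, Finsupp.sum, ← Finset.prod_pow_eq_pow_sum]
  simp only [mul_pow, Finset.prod_mul_distrib]
  ring

variable {N : ℕ}

/-- The degree zero part of the localization of `ℂ[x₀, …, x_N]` at `x_k`. -/
abbrev Chart (k : Fin (N + 1)) : Type :=
  HomogeneousLocalization.Away (grading N) (MvPolynomial.X k)

lemma X_mem_grading (k : Fin (N + 1)) : (MvPolynomial.X k : MvPolynomial _ ℂ) ∈ grading N 1 :=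
  MvPolynomial.isHomogeneous_X ℂ k

/-- The element `x_l / x_k`. -/
def ratio (k l : Fin (N + 1)) : Chart k :=
  HomogeneousLocalization.Away.mk (grading N) (f := MvPolynomial.X k) (d := 1)
    (X_mem_grading k) 1 (MvPolynomial.X l) (by simpa using MvPolynomial.isHomogeneous_X ℂ l)

/-- The inclusion of the constants. -/
def chartConst (k : Fin (N + 1)) : ℂ →+* Chart k :=
  (HomogeneousLocalization.fromZeroRingHom (grading N) _).comp (algebraMap ℂ (grading N 0))

/-- The localization of `ℂ[x₀, …, x_N]` at `x_k`. -/
abbrev ChartLoc (k : Fin (N + 1)) : Type :=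
  Localization.Away (MvPolynomial.X k : MvPolynomial (Fin (N + 1)) ℂ)

/-- The localization map. -/
def toLoc (k : Fin (N + 1)) : MvPolynomial (Fin (N + 1)) ℂ →+* ChartLoc k := algebraMap _ _

/-- The inclusion of the degree zero part. -/
def chartVal (k : Fin (N + 1)) : Chart k →+* ChartLoc k := algebraMap _ _

lemma chartVal_injective (k : Fin (N + 1)) : Function.Injective (chartVal k) :=
  HomogeneousLocalization.val_injective _

lemma val_chartConst (k : Fin (N + 1)) (c : ℂ) :
    chartVal k (chartConst k c) = toLoc k (MvPolynomial.C c) := by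
  rfl

lemma pow_mul_val_mk (k : Fin (N + 1)) (n : ℕ) (p : MvPolynomial (Fin (N + 1)) ℂ)
    (hp : p ∈ grading N (n • 1)) : toLoc k (MvPolynomial.X k) ^ n *
      chartVal k (HomogeneousLocalization.Away.mk (grading N) (X_mem_grading k) n p hp) =
        toLoc k p := by
  have h : chartVal k (HomogeneousLocalization.Away.mk (grading N) (X_mem_grading k) n p hp) =
    Localization.mk p
      (⟨MvPolynomial.X k ^ n, ⟨n, rfl⟩⟩ : Submonoid.powers (MvPolynomial.X k)) :=
      HomogeneousLocalization.Away.val_mk (grading N) n (X_mem_grading k) p hp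
  rw [h, Localization.mk_eq_mk', ← map_pow]
  exact IsLocalization.mk'_spec' (ChartLoc k) p
    (⟨MvPolynomial.X k ^ n, ⟨n, rfl⟩⟩ : Submonoid.powers _)

lemma mul_val_ratio (k l : Fin (N + 1)) :
    toLoc k (MvPolynomial.X k) * chartVal k (ratio k l) = toLoc k (MvPolynomial.X l) := by
  have := pow_mul_val_mk k 1 (MvPolynomial.X l) (by simpa using MvPolynomial.isHomogeneous_X ℂ l)
  rwa [pow_one] at this

/-- Dehomogenization: p(x) = t^n p(x/t) for p homogeneous of degree n. -/
lemma map_eq_pow_mul_eval₂ {σ R A L : Type*} [CommRing R] [CommRing A] [CommRing L]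
    (φ : MvPolynomial σ R →+* L) (v : A →+* L) (c : R →+* A) (r : σ → A) (t : L)
    (hc : ∀ a, v (c a) = φ (MvPolynomial.C a)) (hX : ∀ l, t * v (r l) = φ (MvPolynomial.X l))
    {p : MvPolynomial σ R} {n : ℕ} (hp : p.IsHomogeneous n) : φ p = t ^ n * v (p.eval₂ c r) := by
  have hc' : v.comp c = φ.comp MvPolynomial.C := RingHom.ext hc
  rw [MvPolynomial.hom_eval₂, ← eval₂_mul_of_isHomogeneous _ _ _ hp, hc']
  simp only [hX]
  conv_lhs => rw [← MvPolynomial.eval₂_eta p]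
  rw [MvPolynomial.hom_eval₂]

/-- After multiplication by the unit x_k^n this is dehomogenization. It shows that the constants and
the ratios generate the chart ring. -/
lemma chart_mk_eq_eval₂ (k : Fin (N + 1)) (n : ℕ) (p : MvPolynomial (Fin (N + 1)) ℂ)
    (hp : p ∈ grading N (n • 1)) :
    HomogeneousLocalization.Away.mk (grading N) (X_mem_grading k) n p hp =
      p.eval₂ (chartConst k) (ratio k) := by
  apply chartVal_injective
  have hp' : p.IsHomogeneous n := by simpa using hp
  have h1 := map_eq_pow_mul_eval₂ (toLoc k) (chartVal k) (chartConst k) (ratio k) _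
    (val_chartConst k) (mul_val_ratio k) hp'
  have hu : IsUnit (toLoc k (MvPolynomial.X k) ^ n) :=
    (IsLocalization.Away.algebraMap_isUnit _).pow n
  exact hu.mul_left_cancel ((pow_mul_val_mk k n p hp).trans h1)

lemma chart_ringHom_ext {R : Type*} [CommRing R] (k : Fin (N + 1)) {α β : Chart k →+* R}
    (hc : α.comp (chartConst k) = β.comp (chartConst k)) (h : ∀ l, α (ratio k l) = β (ratio k l)) :
    α = β := by
  ext z
  obtain ⟨n, p, hp, rfl⟩ := HomogeneousLocalization.Away.mk_surjective (grading N)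
    (X_mem_grading k) z
  rw [chart_mk_eq_eval₂, MvPolynomial.hom_eval₂, MvPolynomial.hom_eval₂, hc]
  congr 1
  funext l
  exact h l

/-- Evaluation at x_l = a_l sends x_k to 1, so it extends to the localization at x_k; restrict it to
degree zero. -/
lemma exists_chart_ringHom {R : Type*} [CommRing R] (k : Fin (N + 1)) (φ : ℂ →+* R)
    (a : Fin (N + 1) → R) (ha : a k = 1) : ∃ α : Chart k →+* R,
      α.comp (chartConst k) = φ ∧ ∀ l, α (ratio k l) = a l := by
  let E := MvPolynomial.eval₂Hom φ a
  have hE : IsUnit (E (MvPolynomial.X k)) := by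
    rw [MvPolynomial.coe_eval₂Hom, MvPolynomial.eval₂_X, ha]
    exact isUnit_one
  let L : ChartLoc k →+* R := IsLocalization.Away.lift (MvPolynomial.X k) hE
  have hL : ∀ p, L (toLoc k p) = E p := IsLocalization.Away.lift_eq _ hE
  refine ⟨L.comp (chartVal k), ?_, fun l => ?_⟩
  · ext c
    change L (chartVal k (chartConst k c)) = φ c
    rw [val_chartConst, hL]
    exact MvPolynomial.eval₂_C _ _ _
  · have := congrArg L (mul_val_ratio k l)
    rw [map_mul, hL, hL, MvPolynomial.coe_eval₂Hom, MvPolynomial.eval₂_X, MvPolynomial.eval₂_X,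
      ha, one_mul] at this
    exact this

end Algebra

/-! ### Charts of projective space and their transition functions -/

section Charts

variable {N : ℕ} {T Y : Scheme.{0}}

/-- The open immersion of a standard chart. -/
def chartMap (k : Fin (N + 1)) : Spec (.of (Chart k)) ⟶ projectiveSpace N :=
  Proj.awayι (grading N) (MvPolynomial.X k) (X_mem_grading k) one_pos

instance (k : Fin (N + 1)) : IsOpenImmersion (chartMap k) :=
  inferInstanceAs (IsOpenImmersion (Proj.awayι _ _ _ _))

lemma opensRange_chartMap (k : Fin (N + 1)) : (chartMap k).opensRange = chart k :=
  Proj.opensRange_awayι _ _ _ _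

lemma chartMap_toSpec (k : Fin (N + 1)) :
    chartMap k ≫ projectiveSpace.toSpec N = Spec.map (CommRingCat.ofHom (chartConst k)) := by
  rw [chartMap, projectiveSpace.toSpec, Proj.awayι_toSpecZero_assoc, ← Spec.map_comp]
  rfl

lemma coordRatio_eq (k l : Fin (N + 1)) :
    coordRatio k l = (Proj.awayToSection (grading N) (MvPolynomial.X k)).hom (ratio k l) := rfl

lemma top_le_chartMap_preimage (k : Fin (N + 1)) : ⊤ ≤ chartMap k ⁻¹ᵁ chart k := by
  rw [← opensRange_chartMap, Scheme.Hom.preimage_opensRange]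

lemma awayToSection_appLE (k : Fin (N + 1)) :
    Proj.awayToSection (grading N) (MvPolynomial.X k) ≫
      (chartMap k).appLE (chart k) ⊤ (top_le_chartMap_preimage k) =
        (Scheme.ΓSpecIso (.of (Chart k))).inv := by
  let I := Proj.basicOpenIsoSpec (grading N) (MvPolynomial.X k) (X_mem_grading k) one_pos
  have h0 : I.hom ≫ chartMap k = (chart k).ι := by
    rw [chartMap, ← Proj.basicOpenIsoSpec_inv_ι]
    exact Iso.hom_inv_id_assoc _ _
  have h1 : I.hom.app ⊤ = (Scheme.ΓSpecIso (.of (Chart k))).hom ≫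
      Proj.awayToSection (grading N) (MvPolynomial.X k) ≫ (chart k).topIso.inv :=
    Proj.basicOpenToSpec_app_top _ _
  have h2 : (chartMap k).appLE (chart k) ⊤ (top_le_chartMap_preimage k) ≫ I.hom.app ⊤ =
      (chart k).topIso.inv := by
    rw [Scheme.Hom.app_eq_appLE, Scheme.Hom.appLE_comp_appLE]
    simp only [h0]
    rw [Scheme.Opens.topIso_inv, Scheme.Hom.appLE, Scheme.Opens.ι_app]
    exact ((projectiveSpace N).presheaf.map_comp _ _).symm
  have h3 : IsIso (I.hom.app ⊤) := inferInstance
  rw [← cancel_mono (I.hom.app ⊤), Category.assoc, h2, h1]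
  exact (Iso.inv_hom_id_assoc _ _).symm

/-- The identity (x_l/x_k)(x_k/x_k') = x_l/x_k' is checked at each point p in the localization of
the polynomial ring, after multiplying by x_k x_k', which is a unit there. -/
lemma resO_ratio_mul (k k' l : Fin (N + 1)) :
    resO (inf_le_left : chart k ⊓ chart k' ≤ chart k) (coordRatio k l) *
      resO (inf_le_right : chart k ⊓ chart k' ≤ chart k') (coordRatio k' k) =
        resO inf_le_right (coordRatio k' l) := by
  apply Subtype.ext
  funext p
  have hprime : p.1.asHomogeneousIdeal.toIdeal.IsPrime := p.1.isPrime
  apply HomogeneousLocalization.val_injective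
  let A := Localization.AtPrime p.1.asHomogeneousIdeal.toIdeal
  let v : MvPolynomial (Fin (N + 1)) ℂ → A := algebraMap _ A
  have h : ∀ (j l : Fin (N + 1)) (hj : p.1 ∈ chart j),
      v (MvPolynomial.X j) * (((coordRatio j l).1 ⟨p.1, hj⟩).val : A) = v (MvPolynomial.X l) :=
    fun j l hj => by
    have h1 := ProjectiveSpectrum.Proj.awayToSection_apply (grading N) (MvPolynomial.X j)
      (ratio j l) ⟨p.1, hj⟩
    let L : ChartLoc j →+* A := IsLocalization.map (M := Submonoid.powers (MvPolynomial.X j))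
      (T := p.1.asHomogeneousIdeal.toIdeal.primeCompl) A (RingHom.id _)
        (Submonoid.powers_le.mpr hj)
    have hL : ∀ q, L (toLoc j q) = v q := fun q => IsLocalization.map_eq
      (M := Submonoid.powers (MvPolynomial.X j)) _ q
    have h2 := congrArg L (mul_val_ratio j l)
    rw [map_mul, hL, hL] at h2
    exact (congrArg (v (MvPolynomial.X j) * ·) h1).trans h2
  have hu : ∀ (j : Fin (N + 1)) (hj : p.1 ∈ chart j), IsUnit (v (MvPolynomial.X j)) := fun j hj =>
    IsLocalization.map_units A (⟨MvPolynomial.X j, hj⟩ : p.1.asHomogeneousIdeal.toIdeal.primeCompl)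
  have e1 := h k l p.2.1
  have e2 := h k' k p.2.2
  have e3 := h k' l p.2.2
  refine ((hu k p.2.1).mul (hu k' p.2.2)).mul_left_cancel ?_
  refine Eq.trans (b := v (MvPolynomial.X k) * v (MvPolynomial.X k') *
    (((coordRatio k l).1 ⟨p.1, p.2.1⟩).val * ((coordRatio k' k).1 ⟨p.1, p.2.2⟩).val)) ?_ ?_
  · refine congrArg _ ?_
    exact HomogeneousLocalization.val_mul _ _
  refine Eq.trans (b := v (MvPolynomial.X k) * v (MvPolynomial.X k') *
    ((coordRatio k' l).1 ⟨p.1, p.2.2⟩).val) ?_ rfl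
  linear_combination (v (MvPolynomial.X k') * ((coordRatio k' k).1 ⟨p.1, p.2.2⟩).val) * e1 +
    v (MvPolynomial.X l) * e2 - v (MvPolynomial.X k) * e3

end Charts

/-! ### Morphisms into a single chart -/

section CoordFn

variable {N : ℕ} {T Y : Scheme.{0}}

/-- The function `x_l / x_k` pulled back along `g`, on an open set mapped to `x_k ≠ 0`. -/
def coordFn (g : T ⟶ projectiveSpace N) (k l : Fin (N + 1)) {W : T.Opens}
    (h : W ≤ g ⁻¹ᵁ chart k) : Γ(T, W) :=
  (g.appLE (chart k) W h).hom (coordRatio k l)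

variable (g : T ⟶ projectiveSpace N) {k k' l : Fin (N + 1)} {W W' : T.Opens}

lemma coordFn_le_rfl : coordFn g k l le_rfl = (g.app (chart k)).hom (coordRatio k l) := by
  rw [coordFn, Scheme.Hom.appLE_eq_app]

lemma resO_coordFn (h : W ≤ g ⁻¹ᵁ chart k) (h' : W' ≤ W) :
    resO h' (coordFn g k l h) = coordFn g k l (h'.trans h) :=
  congrArg (fun t => t.hom (coordRatio k l)) (g.appLE_map h (homOfLE h').op)

lemma coordFn_comp (f : Y ⟶ T) {V : Y.Opens} (h : W ≤ g ⁻¹ᵁ chart k) (h' : V ≤ f ⁻¹ᵁ W)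
    (h'' : V ≤ (f ≫ g) ⁻¹ᵁ chart k) :
    coordFn (f ≫ g) k l h'' = (f.appLE W V h').hom (coordFn g k l h) :=
  (congrArg (fun t => t.hom (coordRatio k l)) (f.appLE_comp_appLE g (chart k) W V h h')).symm

lemma coordFn_mul (h : W ≤ g ⁻¹ᵁ chart k) (h' : W ≤ g ⁻¹ᵁ chart k') :
    coordFn g k l h * coordFn g k' k h' = coordFn g k' l h' := by
  have h1 := congrArg (g.appLE (chart k ⊓ chart k') W (le_inf h h')).hom (resO_ratio_mul k k' l)
  rw [map_mul] at h1
  have h2 : ∀ (j i : Fin (N + 1)) (hj : chart k ⊓ chart k' ≤ chart j) (hW : W ≤ g ⁻¹ᵁ chart j),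
      (g.appLE (chart k ⊓ chart k') W (le_inf h h')).hom (resO hj (coordRatio j i)) =
        coordFn g j i hW := fun j i hj hW =>
    congrArg (fun t => t.hom (coordRatio j i)) (g.map_appLE (le_inf h h') (homOfLE hj).op)
  rwa [h2 k l _ h, h2 k' k _ h', h2 k' l _ h'] at h1

lemma ratio_self (k : Fin (N + 1)) : ratio k k = 1 := by
  apply chartVal_injective
  have hu : IsUnit (toLoc k (MvPolynomial.X k)) := IsLocalization.Away.algebraMap_isUnit _
  refine hu.mul_left_cancel ?_
  rw [mul_val_ratio, map_one, mul_one]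

lemma coordFn_self (h : W ≤ g ⁻¹ᵁ chart k) : coordFn g k k h = 1 := by
  rw [coordFn, coordRatio_eq, ratio_self, map_one, map_one]

lemma isUnit_coordFn (h : W ≤ g ⁻¹ᵁ chart k) (h' : W ≤ g ⁻¹ᵁ chart k') :
    IsUnit (coordFn g k k' h) :=
  IsUnit.of_mul_eq_one _ ((coordFn_mul g h h').trans (coordFn_self g h'))

/-- Inside the affine chart k, the preimage of chart l is the basic open set of the ring element
x_l/x_k. -/
lemma basicOpen_coordRatio_le (k l : Fin (N + 1)) :
    (projectiveSpace N).basicOpen (coordRatio k l) ≤ chart l := by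
  intro z hz
  have hzk : z ∈ chart k := (projectiveSpace N).basicOpen_le _ hz
  rw [← opensRange_chartMap] at hzk
  obtain ⟨w, rfl⟩ := hzk
  have h1 : chartMap k ⁻¹ᵁ chart l = PrimeSpectrum.basicOpen (ratio k l) := by
    refine (Proj.awayι_preimage_basicOpen (grading N) (X_mem_grading k) one_pos
      (X_mem_grading l) one_pos).trans ?_
    congr 1
    apply HomogeneousLocalization.val_injective
    simp [ratio]
  have h2 : (Spec (.of (Chart k))).basicOpen ((Scheme.ΓSpecIso (.of (Chart k))).inv.hom
      (ratio k l)) = PrimeSpectrum.basicOpen (ratio k l) :=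
    basicOpen_eq_of_affine (R := .of (Chart k)) (ratio k l)
  have h3 : (Scheme.ΓSpecIso (.of (Chart k))).inv.hom (ratio k l) =
      ((chartMap k).appLE (chart k) ⊤ (top_le_chartMap_preimage k)).hom (coordRatio k l) :=
    (congrArg (fun t => t.hom (ratio k l)) (awayToSection_appLE k)).symm
  have h4 := Scheme.basicOpen_appLE (chartMap k) ⊤ (chart k) (top_le_chartMap_preimage k)
    (coordRatio k l)
  change w ∈ chartMap k ⁻¹ᵁ chart l
  rw [h1, ← h2, h3]
  refine h4.ge ?_
  exact ⟨trivial, hz⟩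

lemma basicOpen_coordFn_le (h : W ≤ g ⁻¹ᵁ chart k) :
    T.basicOpen (coordFn g k l h) ≤ g ⁻¹ᵁ chart l := by
  refine (Scheme.basicOpen_appLE g W (chart k) h (coordRatio k l)).le.trans (inf_le_right.trans ?_)
  exact preimage_le_preimage g (basicOpen_coordRatio_le k l)

lemma exists_mem_chart (z : projectiveSpace N) : ∃ k, z ∈ chart k := by
  have h := Proj.iSup_basicOpen_eq_top' (grading N)
    (fun k : Fin (N + 1) => (MvPolynomial.X k : MvPolynomial _ ℂ))
    (fun k => ⟨1, X_mem_grading k⟩) (by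
      refine top_le_iff.1 fun p _ => ?_
      induction p using MvPolynomial.induction_on with
      | C a => exact Subalgebra.algebraMap_mem _ (algebraMap ℂ (grading N 0) a)
      | add p q hp hq => exact add_mem (hp trivial) (hq trivial)
      | mul_X p k hp => exact mul_mem (hp trivial) (Algebra.subset_adjoin ⟨k, rfl⟩))
  exact Opens.mem_iSup.1 (h.ge (Set.mem_univ z))

lemma toSpecΓ_SpecMap_appTop {R : CommRingCat.{0}} (f : T ⟶ Spec R) :
    T.toSpecΓ ≫ Spec.map ((Scheme.ΓSpecIso R).inv ≫ f.appTop) = f := by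
  rw [Spec.map_comp, ← Scheme.toSpecΓ_naturality_assoc, toSpecΓ_SpecMap_ΓSpecIso_inv,
    Category.comp_id]

/-- Factorization through a chart. -/
lemma exists_chart_factor (h : ⊤ ≤ g ⁻¹ᵁ chart k) :
    ∃ α : CommRingCat.of (Chart k) ⟶ Γ(T, ⊤), g = T.toSpecΓ ≫ Spec.map α ≫ chartMap k := by
  have hr : Set.range g ⊆ Set.range (chartMap k) := by
    rintro _ ⟨t, rfl⟩
    have : g t ∈ chart k := h (Set.mem_univ t)
    rw [← opensRange_chartMap] at this
    exact this
  let f := IsOpenImmersion.lift (chartMap k) g hr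
  refine ⟨(Scheme.ΓSpecIso _).inv ≫ f.appTop, ?_⟩
  have h1 := toSpecΓ_SpecMap_appTop f
  rw [reassoc_of% h1]
  exact (IsOpenImmersion.lift_fac _ _ _).symm

lemma top_le_toSpecΓ_preimage (α : CommRingCat.of (Chart k) ⟶ Γ(T, ⊤)) :
    ⊤ ≤ (T.toSpecΓ ≫ Spec.map α ≫ chartMap k) ⁻¹ᵁ chart k := fun x _ =>
  top_le_chartMap_preimage k (Set.mem_univ ((T.toSpecΓ ≫ Spec.map α) x))

lemma coordFn_toSpecΓ (α : CommRingCat.of (Chart k) ⟶ Γ(T, ⊤)) :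
    coordFn (T.toSpecΓ ≫ Spec.map α ≫ chartMap k) k l (top_le_toSpecΓ_preimage α) =
      α.hom (ratio k l) := by
  have h1 : coordFn (T.toSpecΓ ≫ Spec.map α ≫ chartMap k) k l (top_le_toSpecΓ_preimage α) =
      ((T.toSpecΓ ≫ Spec.map α).appLE ⊤ ⊤ le_top).hom
        (coordFn (chartMap k) k l (top_le_chartMap_preimage k)) := by
    have := coordFn_comp (chartMap k) (k := k) (l := l) (T.toSpecΓ ≫ Spec.map α)
      (top_le_chartMap_preimage k) (le_top : ⊤ ≤ _) (by
        rw [Category.assoc]; exact top_le_toSpecΓ_preimage α)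
    rw [← this]
    congr 1
  have h2 : coordFn (chartMap k) k l (top_le_chartMap_preimage k) =
      (Scheme.ΓSpecIso (.of (Chart k))).inv.hom (ratio k l) :=
    congrArg (fun t => t.hom (ratio k l)) (awayToSection_appLE k)
  have h3 : (Scheme.ΓSpecIso (.of (Chart k))).inv ≫
      (T.toSpecΓ ≫ Spec.map α).appLE ⊤ ⊤ le_top = α := by
    change _ ≫ (T.toSpecΓ ≫ Spec.map α).appLE ⊤ ((T.toSpecΓ ≫ Spec.map α) ⁻¹ᵁ ⊤) le_rfl = α
    rw [Scheme.Hom.appLE_eq_app]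
    simp
  rw [h1, h2]
  exact congrArg (fun t => t.hom (ratio k l)) h3

lemma toSpecΓ_chart_toSpec (α : CommRingCat.of (Chart k) ⟶ Γ(T, ⊤)) :
    (T.toSpecΓ ≫ Spec.map α ≫ chartMap k) ≫ projectiveSpace.toSpec N =
      T.toSpecΓ ≫ Spec.map (CommRingCat.ofHom (chartConst k) ≫ α) := by
  rw [Category.assoc, Category.assoc, chartMap_toSpec, Spec.map_comp]

lemma toSpecΓ_SpecMap_injective {R : CommRingCat.{0}} {α β : R ⟶ Γ(T, ⊤)}
    (h : T.toSpecΓ ≫ Spec.map α = T.toSpecΓ ≫ Spec.map β) : α = β := by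
  have := congrArg (fun f => (Scheme.ΓSpecIso R).inv ≫ f.appTop) h
  simpa using this

/-- Both maps factor through the affine chart k and so are ring homomorphisms; these are determined
by the constants (the structure morphism) and the ratios. -/
lemma projective_hom_ext {a b : T ⟶ projectiveSpace N} (k : Fin (N + 1))
    (ha : ⊤ ≤ a ⁻¹ᵁ chart k) (hb : ⊤ ≤ b ⁻¹ᵁ chart k)
    (hs : a ≫ projectiveSpace.toSpec N = b ≫ projectiveSpace.toSpec N)
    (h : ∀ l, coordFn a k l ha = coordFn b k l hb) : a = b := by
  obtain ⟨α, rfl⟩ := exists_chart_factor a ha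
  obtain ⟨β, rfl⟩ := exists_chart_factor b hb
  rw [toSpecΓ_chart_toSpec, toSpecΓ_chart_toSpec] at hs
  have hc := congrArg CommRingCat.Hom.hom (toSpecΓ_SpecMap_injective hs)
  have : α = β := by
    ext1
    refine chart_ringHom_ext k hc fun l => ?_
    rw [← coordFn_toSpecΓ, ← coordFn_toSpecΓ]
    exact h l
  rw [this]

lemma exists_projective_hom (q : T ⟶ Spec (.of ℂ)) (k : Fin (N + 1)) (a : Fin (N + 1) → Γ(T, ⊤))
    (ha : a k = 1) : ∃ (g : T ⟶ projectiveSpace N) (h : ⊤ ≤ g ⁻¹ᵁ chart k),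
      g ≫ projectiveSpace.toSpec N = q ∧ ∀ l, coordFn g k l h = a l := by
  let φ : CommRingCat.of ℂ ⟶ Γ(T, ⊤) := (Scheme.ΓSpecIso _).inv ≫ q.appTop
  obtain ⟨α, hα, hl⟩ := exists_chart_ringHom k φ.hom a ha
  refine ⟨T.toSpecΓ ≫ Spec.map (CommRingCat.ofHom α) ≫ chartMap k,
    top_le_toSpecΓ_preimage _, ?_, fun l => (coordFn_toSpecΓ _).trans (hl l)⟩
  rw [toSpecΓ_chart_toSpec]
  have : CommRingCat.ofHom (chartConst k) ≫ CommRingCat.ofHom α = φ := by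
    ext1
    exact hα
  rw [this]
  exact toSpecΓ_SpecMap_appTop q

end CoordFn

/-! ### Morphisms to projective space given by sections -/

section Glue

variable {N : ℕ} {T Y : Scheme.{0}}

lemma appLE_resO {Z : Scheme.{0}} (f : T ⟶ Z) {U U' : Z.Opens} {W : T.Opens} (h : U' ≤ U)
    (h' : W ≤ f ⁻¹ᵁ U') (r : Γ(Z, U)) :
    (f.appLE U' W h').hom (resO h r) = (f.appLE U W (fun _ hx => h (h' hx))).hom r :=
  congrArg (fun t => t.hom r) (f.map_appLE h' (homOfLE h).op)

lemma appLE_appLE {Z : Scheme.{0}} (f : T ⟶ Z) (g : Z ⟶ Y) {U : Y.Opens} {V : Z.Opens}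
    {W : T.Opens} (h : V ≤ g ⁻¹ᵁ U) (h' : W ≤ f ⁻¹ᵁ V) (r : Γ(Y, U)) :
    (f.appLE V W h').hom ((g.appLE U V h).hom r) =
      ((f ≫ g).appLE U W (fun _ hx => h (h' hx))).hom r :=
  congrArg (fun t => t.hom r) (f.appLE_comp_appLE g U V W h h')

lemma top_le_preimage_top (f : T ⟶ Y) : (⊤ : T.Opens) ≤ f ⁻¹ᵁ ⊤ := fun _ _ => trivial

lemma top_le_ι_preimage (V : Y.Opens) : ⊤ ≤ V.ι ⁻¹ᵁ V := fun x _ => x.2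

lemma ι_appLE_injective (V : Y.Opens) :
    Function.Injective (V.ι.appLE V ⊤ (top_le_ι_preimage V)).hom := by
  have h : V.ι.appLE V ⊤ (top_le_ι_preimage V) = V.topIso.inv := by
    rw [Scheme.Opens.topIso_inv, Scheme.Hom.appLE, Scheme.Opens.ι_app]
    exact (Y.presheaf.map_comp _ _).symm
  rw [h]
  exact (ConcreteCategory.bijective_of_isIso V.topIso.inv).1

/-- Here a i l plays the role of τ_l/τ_{k i}, and `hc` is the change of denominator. The local maps
into charts agree on overlaps and glue. -/
lemma exists_projective_hom_of_cover (q : Y ⟶ Spec (.of ℂ)) {ι : Type} (V : ι → Y.Opens)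
    (hV : ∀ y, ∃ i, y ∈ V i) (k : ι → Fin (N + 1)) (a : ∀ i, Fin (N + 1) → Γ(Y, V i))
    (ha : ∀ i, a i (k i) = 1)
    (hc : ∀ i j l, resO (inf_le_right : V i ⊓ V j ≤ V j) (a j l) *
      resO (inf_le_left : V i ⊓ V j ≤ V i) (a i (k j)) = resO inf_le_left (a i l)) :
    ∃ g : Y ⟶ projectiveSpace N, g ≫ projectiveSpace.toSpec N = q ∧
      ∀ i, ∃ h : V i ≤ g ⁻¹ᵁ chart (k i), ∀ l, coordFn g (k i) l h = a i l := by
  choose f hf hq hfa using fun i => exists_projective_hom ((V i).ι ≫ q) (k i)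
    (fun l => ((V i).ι.appLE (V i) ⊤ (top_le_ι_preimage _)).hom (a i l))
    (by rw [ha, map_one])
  let 𝒰 : Y.OpenCover := Y.openCoverOfIsOpenCover V (by
    rw [TopologicalSpace.IsOpenCover]
    exact top_le_iff.1 fun y _ => Opens.mem_iSup.2 (hV y))
  let f' : ∀ i : 𝒰.I₀, 𝒰.X i ⟶ projectiveSpace N := f
  have compat : ∀ i j : ι, Limits.pullback.fst (V i).ι (V j).ι ≫ f i =
      Limits.pullback.snd (V i).ι (V j).ι ≫ f j := by
    intro i j
    let r := Limits.pullback.fst (V i).ι (V j).ι ≫ (V i).ι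
    have hr : Limits.pullback.snd (V i).ι (V j).ι ≫ (V j).ι = r := Limits.pullback.condition.symm
    have hri : ⊤ ≤ r ⁻¹ᵁ V i := fun x _ => (Limits.pullback.fst (V i).ι (V j).ι x).2
    have hrj : ⊤ ≤ r ⁻¹ᵁ V j := fun x _ => by
      rw [← hr]
      exact (Limits.pullback.snd (V i).ι (V j).ι x).2
    have hrij : ⊤ ≤ r ⁻¹ᵁ (V i ⊓ V j) := le_inf hri hrj
    have h1 : ⊤ ≤ (Limits.pullback.fst (V i).ι (V j).ι ≫ f i) ⁻¹ᵁ chart (k i) := fun x _ =>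
      hf i (Set.mem_univ (Limits.pullback.fst (V i).ι (V j).ι x))
    have h2 : ⊤ ≤ (Limits.pullback.snd (V i).ι (V j).ι ≫ f j) ⁻¹ᵁ chart (k j) := fun x _ =>
      hf j (Set.mem_univ (Limits.pullback.snd (V i).ι (V j).ι x))
    have hA : ∀ l, coordFn (Limits.pullback.fst (V i).ι (V j).ι ≫ f i) (k i) l h1 =
        (r.appLE (V i) ⊤ hri).hom (a i l) := fun l => by
      rw [coordFn_comp (f i) _ (hf i) (top_le_preimage_top _), hfa, appLE_appLE]
    have hB : ∀ l, coordFn (Limits.pullback.snd (V i).ι (V j).ι ≫ f j) (k j) l h2 =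
        (r.appLE (V j) ⊤ hrj).hom (a j l) := fun l => by
      rw [coordFn_comp (f j) _ (hf j) (top_le_preimage_top _), hfa, appLE_appLE]
      simp only [hr]
    have hAB : ∀ l, (r.appLE (V j) ⊤ hrj).hom (a j l) * (r.appLE (V i) ⊤ hri).hom (a i (k j)) =
        (r.appLE (V i) ⊤ hri).hom (a i l) := fun l => by
      have := congrArg (r.appLE (V i ⊓ V j) ⊤ hrij).hom (hc i j l)
      rwa [map_mul, appLE_resO, appLE_resO, appLE_resO] at this
    -- With l = k i the change of denominator says that a j (k i) and a i (k j) are mutually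
    -- inverse, so on the overlap the j-th map also lands in chart k i.
    have hu := hAB (k i)
    rw [ha, map_one] at hu
    have h2' : ⊤ ≤ (Limits.pullback.snd (V i).ι (V j).ι ≫ f j) ⁻¹ᵁ chart (k i) := by
      refine le_trans ?_ (basicOpen_coordFn_le _ (l := k i) h2)
      rw [hB, Scheme.basicOpen_of_isUnit _ (IsUnit.of_mul_eq_one _ hu)]
    refine projective_hom_ext (k i) h1 h2' ?_ fun l => ?_
    · rw [Category.assoc, Category.assoc, hq, hq, ← Category.assoc, ← Category.assoc, hr]
    · have h3 := coordFn_mul (Limits.pullback.snd (V i).ι (V j).ι ≫ f j) (l := l) h2' h2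
      rw [hB, hB] at h3
      rw [hA, ← hAB, ← h3, mul_assoc, hu, mul_one]
  let g := 𝒰.glueMorphisms f' compat
  have hg : ∀ i, (V i).ι ≫ g = f i := fun i => 𝒰.ι_glueMorphisms f' compat i
  refine ⟨g, ?_, fun i => ?_⟩
  · refine 𝒰.hom_ext _ _ fun i => ?_
    change (V i).ι ≫ g ≫ _ = (V i).ι ≫ q
    exact (Category.assoc _ _ _).symm.trans ((congrArg (· ≫ _) (hg i)).trans (hq i))
  · have h : V i ≤ g ⁻¹ᵁ chart (k i) := fun y hy => by
      have : f i ⟨y, hy⟩ ∈ chart (k i) := hf i (Set.mem_univ _)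
      rw [← hg] at this
      exact this
    refine ⟨h, fun l => ι_appLE_injective (V i) ?_⟩
    rw [← hfa, ← coordFn_comp g (V i).ι h (top_le_ι_preimage _) (fun x _ => h x.2)]
    congr 1
    exact hg i

variable {L : Y.Modules} {τ : Fin (N + 1) → Γ(L, ⊤)} {g : Y ⟶ projectiveSpace N}

lemma IsGivenBySections.isFrame (hg : IsGivenBySections g L τ) {k : Fin (N + 1)} {W : Y.Opens}
    (h : W ≤ g ⁻¹ᵁ chart k) : IsFrame (res (le_top : W ≤ ⊤) (τ k)) := by
  have := (hg k).1.res h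
  rwa [res_res] at this

lemma IsGivenBySections.res_eq (hg : IsGivenBySections g L τ) {k : Fin (N + 1)} {W : Y.Opens}
    (h : W ≤ g ⁻¹ᵁ chart k) (l : Fin (N + 1)) :
    res (le_top : W ≤ ⊤) (τ l) = coordFn g k l h • res le_top (τ k) := by
  have := congrArg (res h) ((hg k).2 l)
  rwa [res_smul, res_res, res_res, ← coordFn_le_rfl, resO_coordFn] at this

/-- The preimage of chart k is exactly where τ_k does not vanish. At a point of chart l where τ_k is
a frame, τ_k = (x_k/x_l) • τ_l with both frames, so x_k/x_l is a unit and the point lies in chart k.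
-/
lemma IsGivenBySections.preimage_inf (hg : IsGivenBySections g L τ) {k : Fin (N + 1)}
    {V : Y.Opens} {e : Γ(L, V)} (he : IsFrame e) {a : Γ(Y, V)}
    (ha : res le_top (τ k) = a • e) : V ⊓ g ⁻¹ᵁ chart k = Y.basicOpen a := by
  apply le_antisymm
  · refine mem_basicOpen_of_isFrame inf_le_left he a ?_
    rw [← ha, res_res]
    exact hg.isFrame inf_le_right
  · refine le_inf (Y.basicOpen_le a) fun y hy => ?_
    obtain ⟨l, hl⟩ := exists_mem_chart (g y)
    have h1 : IsFrame (res (inf_le_left : Y.basicOpen a ⊓ g ⁻¹ᵁ chart l ≤ _)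
        (res (Y.basicOpen_le a) (a • e))) := (isFrame_res_basicOpen he a).res _
    rw [← ha, res_res, res_res, hg.res_eq inf_le_right] at h1
    have h2 : IsFrame (res (le_top : Y.basicOpen a ⊓ g ⁻¹ᵁ chart l ≤ ⊤) (τ l)) :=
      hg.isFrame inf_le_right
    have h3 := h2.isUnit_of_smul h1
    have h4 := basicOpen_coordFn_le g (k := l) (l := k)
      (inf_le_right : Y.basicOpen a ⊓ g ⁻¹ᵁ chart l ≤ _)
    rw [Scheme.basicOpen_of_isUnit _ h3] at h4
    exact h4 ⟨hy, hl⟩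

lemma exists_isGivenBySections (q : Y ⟶ Spec (.of ℂ)) (τ : Fin (N + 1) → Γ(L, ⊤))
    (h : ∀ y, ∃ (k : Fin (N + 1)) (V : Y.Opens), y ∈ V ∧ IsFrame (res (le_top : V ≤ ⊤) (τ k))) :
    ∃ g : Y ⟶ projectiveSpace N, g ≫ projectiveSpace.toSpec N = q ∧ IsGivenBySections g L τ := by
  choose k V hy hV using h
  choose a ha using fun y l => (hV y).exists_smul (res le_top (τ l))
  have ha' : ∀ (y : Y) (W : Y.Opens) (hW : W ≤ V y) (l : Fin (N + 1)),
      res (le_top : W ≤ ⊤) (τ l) = resO hW (a y l) • res le_top (τ (k y)) := fun y W hW l => by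
    have := congrArg (res hW) (ha y l)
    rwa [res_smul, res_res, res_res] at this
  have h1 : ∀ y, a y (k y) = 1 := fun y => (hV y).smul_inj ((ha y (k y)).symm.trans
    (one_smul _ _).symm)
  obtain ⟨g, hgq, hg⟩ := exists_projective_hom_of_cover q V (fun y => ⟨y, hy y⟩) k a h1
    (fun y z l => by
      have hf := (hV y).res (inf_le_left : V y ⊓ V z ≤ V y)
      rw [res_res] at hf
      refine hf.smul_inj ?_
      rw [mul_smul, ← ha', ← ha', ← ha'])
  choose hVg hga using hg
  have ha'' : ∀ (y : Y) (W : Y.Opens) (hW : W ≤ V y) (l : Fin (N + 1)),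
      res (le_top : W ≤ ⊤) (τ l) =
        coordFn g (k y) l (hW.trans (hVg y)) • res le_top (τ (k y)) := fun y W hW l => by
    rw [ha' y W hW, ← hga, resO_coordFn]
  refine ⟨g, hgq, fun j => ⟨?_, fun l => ?_⟩⟩
  · refine isFrame_of_nhds fun y hyj => ⟨g ⁻¹ᵁ chart j ⊓ V y, inf_le_left, ⟨hyj, hy y⟩, ?_⟩
    rw [res_res, ha'' y _ inf_le_right]
    have hf := (hV y).res (inf_le_right : g ⁻¹ᵁ chart j ⊓ V y ≤ V y)
    rw [res_res] at hf
    exact hf.smul_of_isUnit (isUnit_coordFn g _ inf_le_left)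
  · refine eq_of_res_eq_nhds fun y hyj => ⟨g ⁻¹ᵁ chart j ⊓ V y, inf_le_left, ⟨hyj, hy y⟩, ?_⟩
    rw [res_smul, res_res, res_res, ← coordFn_le_rfl, resO_coordFn, ha'' y _ inf_le_right l,
      ha'' y _ inf_le_right j, ← mul_smul, coordFn_mul g (inf_le_left)]

end Glue

/-! ### Sections of π^*H and sections of H ⊗ N -/

section Cover

variable {X Y : Scheme.{0}} {π : Y ⟶ X} {H N : X.Modules} {U V : X.Opens}

/-- The function on `π⁻¹U` given by a section of a module over `U` mapping to `π_* O_Y`. -/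
def liftFn (ι : N ⟶ (Scheme.Modules.pushforward π).obj (structureModule Y)) (m : Γ(N, U)) :
    Γ(Y, π ⁻¹ᵁ U) :=
  show Γ(Y, π ⁻¹ᵁ U) from (ι.app U).hom m

variable (ι : N ⟶ (Scheme.Modules.pushforward π).obj (structureModule Y))

lemma liftFn_smul (r : Γ(X, U)) (m : Γ(N, U)) :
    liftFn ι (r • m) = (π.app U).hom r * liftFn ι m :=
  app_smul ι r m

lemma liftFn_res (h : V ≤ U) (m : Γ(N, U)) :
    liftFn ι (res h m) = resO (preimage_le_preimage π h) (liftFn ι m) :=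
  app_res ι h m

variable {ι}

/-- Gluing over all pairs satisfying R, rather than over chosen ones, makes the result satisfy its
formula in every frame. -/
lemma exists_section_of_compat {L : X.Modules} (R : ∀ U : X.Opens, Γ(L, U) → Prop)
    (hR : ∀ x : X, ∃ (U : X.Opens) (s : Γ(L, U)), x ∈ U ∧ R U s)
    (h : ∀ (U V : X.Opens) (s : Γ(L, U)) (t : Γ(L, V)), R U s → R V t →
      ∃ (W : X.Opens) (hU : W ≤ U) (hV : W ≤ V), U ⊓ V ≤ W ∧ res hU s = res hV t) :
    ∃ t : Γ(L, ⊤), ∀ (U : X.Opens) (s : Γ(L, U)), R U s → res le_top t = s := by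
  let I : Type := {i : Σ U : X.Opens, Γ(L, U) // R i.1 i.2}
  obtain ⟨t, ht⟩ := exists_glue (M := L) (V := ⊤) (fun i : I => i.1.1) (fun _ => le_top)
    (fun x _ => by
      obtain ⟨U, s, hx, hs⟩ := hR x
      exact Opens.mem_iSup.2 ⟨⟨⟨U, s⟩, hs⟩, hx⟩)
    (fun i => i.1.2) (fun i j => by
      obtain ⟨W, hU, hV, hW, e⟩ := h _ _ _ _ i.2 j.2
      exact ⟨Unit, fun _ => W, fun _ => hU, fun _ => hV,
        fun y hy => Opens.mem_iSup.2 ⟨(), hW hy⟩, fun _ => e⟩)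
  exact ⟨t, fun U s hs => ht ⟨⟨U, s⟩, hs⟩⟩

lemma liftFn_smul_pullbackSection_eq {e e' : Γ(H, U)} {m m' : Γ(N, U)} (he : IsFrame e)
    (h : tmul e m = tmul e' m') :
    liftFn ι m • pullbackSection π e = liftFn ι m' • pullbackSection π e' := by
  obtain ⟨r, rfl⟩ := he.exists_smul e'
  rw [smul_tmul, ← tmul_smul] at h
  rw [he.tmul_inj h, liftFn_smul, pullbackSection_smul, mul_comm, mul_smul]

lemma res_liftFn_smul (h : V ≤ U) (e : Γ(H, U)) (m : Γ(N, U)) :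
    res (preimage_le_preimage π h) (liftFn ι m • pullbackSection π e) =
      liftFn ι (res h m) • pullbackSection π (res h e) := by
  rw [res_smul, liftFn_res, pullbackSection_res]

/-- The map H ⊗ N ⟶ π_*π^*H, e ⊗ m ↦ ι(m) • π^*e, on global sections. -/
lemma exists_pullback_section
    (ι : N ⟶ (Scheme.Modules.pushforward π).obj (structureModule Y))
    (hH : IsLineBundle H) (v : Γ(tensor H N, ⊤)) :
    ∃ t : Γ((Scheme.Modules.pullback π).obj H, ⊤),
      ∀ (U : X.Opens) (e : Γ(H, U)) (m : Γ(N, U)), IsFrame e → res le_top v = tmul e m →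
        res le_top t = liftFn ι m • pullbackSection π e := by
  obtain ⟨t, ht⟩ := exists_section_of_compat (L := (Scheme.Modules.pullback π).obj H)
    (fun W s => ∃ (U : X.Opens) (e : Γ(H, U)) (m : Γ(N, U)) (hW : W = π ⁻¹ᵁ U), IsFrame e ∧
      res le_top v = tmul e m ∧ s = res hW.le (liftFn ι m • pullbackSection π e))
    (fun y => by
      obtain ⟨U, e, hy, he⟩ := hH (π y)
      obtain ⟨m, hm⟩ := he.tmul_surj (res le_top v)
      exact ⟨π ⁻¹ᵁ U, _, hy, U, e, m, rfl, he, hm, rfl⟩)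
    (by
      rintro _ _ _ _ ⟨U, e, m, rfl, he, hm, rfl⟩ ⟨U', e', m', rfl, -, hm', rfl⟩
      refine ⟨π ⁻¹ᵁ (U ⊓ U'), preimage_le_preimage π inf_le_left,
        preimage_le_preimage π inf_le_right, fun _ => id, ?_⟩
      rw [res_self, res_self, res_liftFn_smul inf_le_left, res_liftFn_smul inf_le_right]
      refine liftFn_smul_pullbackSection_eq (he.res _) ?_
      rw [← res_tmul, ← res_tmul, ← hm, ← hm', res_res, res_res])
  exact ⟨t, fun U e m he hv => (ht _ _ ⟨U, e, m, rfl, he, hv, rfl⟩).trans (res_self _)⟩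

/-- Independence of the frame: if e' = r e, uniqueness of the splitting gives m = r m', and r moves
across the tensor sign. -/
lemma tmul_eq_of_pullbackSection_eq (hι : Function.Bijective fun a : Γ(X, U) × Γ(N, U) =>
      (π.app U).hom a.1 + liftFn ι a.2) {e e' : Γ(H, U)} {u u' : Γ(X, U)} {m m' : Γ(N, U)}
    (he : IsFrame e) (h : ((π.app U).hom u + liftFn ι m) • pullbackSection π e =
        ((π.app U).hom u' + liftFn ι m') • pullbackSection π e') : tmul e m = tmul e' m' := by
  obtain ⟨r, rfl⟩ := he.exists_smul e'
  rw [pullbackSection_smul, ← mul_smul, mul_comm, mul_add, ← liftFn_smul, ← map_mul] at h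
  have h1 := hι.1 (a₁ := (u, m)) (a₂ := (r * u', r • m')) ((he.pullbackSection π).smul_inj h)
  have h2 : m = r • m' := (Prod.ext_iff.1 h1).2
  rw [smul_tmul, ← tmul_smul, h2]

lemma res_lift_add_smul (h : V ≤ U) {e : Γ(H, U)} {u : Γ(X, U)} {m : Γ(N, U)}
    {t : Γ((Scheme.Modules.pullback π).obj H, ⊤)}
    (ht : res le_top t = ((π.app U).hom u + liftFn ι m) • pullbackSection π e) :
    res (le_top : π ⁻¹ᵁ V ≤ ⊤) t =
      ((π.app V).hom (resO h u) + liftFn ι (res h m)) • pullbackSection π (res h e) := by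
  have h1 := congrArg (res (preimage_le_preimage π h)) ht
  rw [res_res, res_smul, map_add, ← pullbackSection_res] at h1
  have h2 := hom_app_resO π h u
  rw [h1, h2, liftFn_res]

/-- The projection of a section of π^*H to its H ⊗ N component. -/
lemma exists_tensor_section (hH : IsLineBundle H)
    (hι : ∀ U : X.Opens, Function.Bijective fun a : Γ(X, U) × Γ(N, U) =>
      (π.app U).hom a.1 + liftFn ι a.2) (t : Γ((Scheme.Modules.pullback π).obj H, ⊤)) :
    ∃ v : Γ(tensor H N, ⊤), ∀ (U : X.Opens) (e : Γ(H, U)) (u : Γ(X, U)) (m : Γ(N, U)),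
      IsFrame e → res le_top t = ((π.app U).hom u + liftFn ι m) • pullbackSection π e →
        res le_top v = tmul e m := by
  obtain ⟨v, hv⟩ := exists_section_of_compat (L := tensor H N)
    (fun U s => ∃ (e : Γ(H, U)) (u : Γ(X, U)) (m : Γ(N, U)), IsFrame e ∧
      res le_top t = ((π.app U).hom u + liftFn ι m) • pullbackSection π e ∧ s = tmul e m)
    (fun x => by
      obtain ⟨U, e, hx, he⟩ := hH x
      obtain ⟨α, hα⟩ := (he.pullbackSection π).exists_smul (res le_top t)
      obtain ⟨⟨u, m⟩, rfl⟩ := (hι U).2 α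
      exact ⟨U, _, hx, e, u, m, he, hα, rfl⟩)
    (by
      rintro U U' _ _ ⟨e, u, m, he, ht, rfl⟩ ⟨e', u', m', -, ht', rfl⟩
      refine ⟨U ⊓ U', inf_le_left, inf_le_right, le_rfl, ?_⟩
      have h1 := res_lift_add_smul (inf_le_left : U ⊓ U' ≤ U) ht
      have h2 := res_lift_add_smul (inf_le_right : U ⊓ U' ≤ U') ht'
      rw [res_tmul, res_tmul]
      exact tmul_eq_of_pullbackSection_eq (hι _) (he.res _) (h1.symm.trans h2))
  exact ⟨v, fun U e u m he h => hv U _ ⟨e, u, m, he, h, rfl⟩⟩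

lemma IsGivenBySections.isLineBundle {n : ℕ} {f : X ⟶ projectiveSpace n}
    {s : Fin (n + 1) → Γ(H, ⊤)} (hf : IsGivenBySections f H s) : IsLineBundle H := fun x => by
  obtain ⟨k, hk⟩ := exists_mem_chart (f x)
  exact ⟨_, _, hk, (hf k).1⟩

lemma IsLineBundle.tensor (hH : IsLineBundle H) (hN : IsLineBundle N) :
    IsLineBundle (tensor H N) := fun x => by
  obtain ⟨U, e, hx, he⟩ := hH x
  obtain ⟨V, f, hx', hf⟩ := hN x
  exact ⟨U ⊓ V, _, ⟨hx, hx'⟩, (he.res inf_le_left).tmul (hf.res inf_le_right)⟩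

end Cover

/-! ### Properness of projective space and finiteness of π -/

section Finite

instance isProper_toSpec (n : ℕ) : IsProper (projectiveSpace.toSpec n) := by
  -- A homogeneous polynomial of degree 0 is constant, so the base change from Spec of the
  -- degree-zero part to Spec ℂ is finite.
  have hs : Function.Surjective (algebraMap ℂ (grading n 0)) := fun ⟨q, hq⟩ => by
    refine ⟨q.coeff 0, Subtype.ext ?_⟩
    have h := MvPolynomial.totalDegree_eq_zero_iff_eq_C.1
      (Nat.le_zero.1 (MvPolynomial.IsHomogeneous.totalDegree_le hq))
    exact h.symm
  have : IsFinite (Spec.map (CommRingCat.ofHom (algebraMap ℂ (grading n 0)))) :=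
    (IsFinite.SpecMap_iff _).2 (RingHom.Finite.of_surjective _ hs)
  have : IsScalarTower ℂ (grading n 0) (MvPolynomial (Fin (n + 1)) ℂ) :=
    ⟨fun a b c => smul_mul_assoc a (b : MvPolynomial (Fin (n + 1)) ℂ) c⟩
  have : Algebra.FiniteType (grading n 0) (MvPolynomial (Fin (n + 1)) ℂ) :=
    Algebra.FiniteType.of_restrictScalars_finiteType ℂ _ _
  unfold projectiveSpace.toSpec
  infer_instance

lemma ringHom_finite_of_pair {A B : Type*} [CommRing A] [CommRing B] (f : A →+* B) (w : B)
    (h : ∀ c, ∃ a b, c = f a + f b * w) : f.Finite := by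
  algebraize [f]
  change Module.Finite A B
  refine Module.Finite.of_surjective (LinearMap.coprod (LinearMap.toSpanSingleton A B 1)
    (LinearMap.toSpanSingleton A B w)) fun c => ?_
  obtain ⟨a, b, rfl⟩ := h c
  refine ⟨(a, b), ?_⟩
  simp [Algebra.smul_def, RingHom.algebraMap_toAlgebra]

variable {X Y : Scheme.{0}} {π : Y ⟶ X} {N : X.Modules} {U V : X.Opens}
  {ι : N ⟶ (Scheme.Modules.pushforward π).obj (structureModule Y)}

lemma exists_eq_add_mul (hι : Function.Surjective fun a : Γ(X, U) × Γ(N, U) =>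
      (π.app U).hom a.1 + liftFn ι a.2) {ε : Γ(N, U)} (hε : IsFrame ε) (c : Γ(Y, π ⁻¹ᵁ U)) :
    ∃ a b, c = (π.app U).hom a + (π.app U).hom b * liftFn ι ε := by
  obtain ⟨⟨a, m⟩, rfl⟩ := hι c
  obtain ⟨b, rfl⟩ := hε.exists_smul m
  exact ⟨a, b, congrArg _ (liftFn_smul ι b ε)⟩

lemma exists_affine_frame {L : X.Modules} (hL : IsLineBundle L) (hN : IsLineBundle N) (x : X) :
    ∃ (U : X.Opens) (e : Γ(L, U)) (ε : Γ(N, U)), x ∈ U ∧ IsAffineOpen U ∧ IsFrame e ∧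
      IsFrame ε := by
  obtain ⟨U, e, hxU, he⟩ := hL x
  obtain ⟨V, ε, hxV, hε⟩ := hN x
  obtain ⟨W, hW, hxW, hWU⟩ := exists_isAffineOpen_mem_and_subset (U := U ⊓ V) ⟨hxU, hxV⟩
  exact ⟨W, _, _, hxW, hW, he.res (hWU.trans inf_le_left), hε.res (hWU.trans inf_le_right)⟩

/-- Finiteness is local on the target, and over an affine open set with a frame ε of N the algebra
is generated as a module by 1 and ι(ε). -/
lemma isFinite_of_bijective [IsAffineHom π] (hN : IsLineBundle N)
    (hι : ∀ U : X.Opens, Function.Bijective fun a : Γ(X, U) × Γ(N, U) =>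
      (π.app U).hom a.1 + liftFn ι a.2) : IsFinite π := by
  choose U _ ε hxU hU _ hε using fun x => exists_affine_frame hN hN x
  have h : HasAffineProperty @IsFinite (affineAnd RingHom.Finite) := by
    refine (HasAffineProperty.affineAnd_iff _ RingHom.finite_respectsIso
      RingHom.finite_localizationPreserves.away RingHom.finite_ofLocalizationSpan).2
      fun f => isFinite_iff f
  refine HasAffineProperty.of_iSup_eq_top (P := @IsFinite) (fun x => ⟨U x, hU x⟩)
    (top_le_iff.1 fun x _ => Opens.mem_iSup.2 ⟨x, hxU x⟩) fun x => ?_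
  refine ⟨(hU x).preimage π, ?_⟩
  change ((π ∣_ U x).appTop).hom.Finite
  have key : ∀ W : X.Opens, W = U x → (π.app W).hom.Finite := by
    rintro _ rfl
    exact ringHom_finite_of_pair _ _ (exists_eq_add_mul (hι _).2 (hε x))
  have hW := key _ (U x).ι_image_top
  have e := morphismRestrict_appTop π (U x)
  generalize_proofs at e
  refine (congrArg (fun t : Γ(U x, ⊤) ⟶ Γ(π ⁻¹ᵁ U x, ⊤) => t.hom.Finite) e).mpr ?_
  exact RingHom.Finite.comp (RingHom.Finite.of_surjective _
    (ConcreteCategory.bijective_of_isIso (Y.presheaf.map (eqToHom _).op)).2) hW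

end Finite

/-! ### The map g is a monomorphism -/

section Mono

variable {T X Y : Scheme.{0}}

lemma hom_ext_of_nhds {a b : T ⟶ Y}
    (h : ∀ t : T, ∃ W : T.Opens, t ∈ W ∧ W.ι ≫ a = W.ι ≫ b) : a = b := by
  choose W hW e using h
  let 𝒰 : T.OpenCover := T.openCoverOfIsOpenCover W (by
    rw [TopologicalSpace.IsOpenCover]
    exact top_le_iff.1 fun t _ => Opens.mem_iSup.2 ⟨t, hW t⟩)
  exact 𝒰.hom_ext _ _ fun t => e t

lemma hom_ext_of_appLE {a b : T ⟶ Y} {V : Y.Opens} (hV : IsAffineOpen V) (ha : ⊤ ≤ a ⁻¹ᵁ V)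
    (hb : ⊤ ≤ b ⁻¹ᵁ V) (h : ∀ r, (a.appLE V ⊤ ha).hom r = (b.appLE V ⊤ hb).hom r) : a = b := by
  have : IsAffine V := hV
  have hr : ∀ (c : T ⟶ Y), ⊤ ≤ c ⁻¹ᵁ V → Set.range c ⊆ Set.range V.ι := by
    rintro c hc _ ⟨t, rfl⟩
    rw [Scheme.Opens.range_ι]
    exact hc (Set.mem_univ t)
  obtain ⟨a', rfl⟩ : ∃ a', a' ≫ V.ι = a := ⟨_, IsOpenImmersion.lift_fac V.ι a (hr a ha)⟩
  obtain ⟨b', rfl⟩ : ∃ b', b' ≫ V.ι = b := ⟨_, IsOpenImmersion.lift_fac V.ι b (hr b hb)⟩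
  refine congrArg (· ≫ V.ι) (ext_of_isAffine ?_)
  have hι : IsIso (V.ι.appLE V ⊤ (top_le_ι_preimage V)) := by
    have h : V.ι.appLE V ⊤ (top_le_ι_preimage V) = V.topIso.inv := by
      rw [Scheme.Opens.topIso_inv, Scheme.Hom.appLE, Scheme.Opens.ι_app]
      exact (Y.presheaf.map_comp _ _).symm
    rw [h]
    infer_instance
  rw [← cancel_epi (V.ι.appLE V ⊤ (top_le_ι_preimage V)), Scheme.Hom.appTop, Scheme.Hom.appTop,
    ← Scheme.Hom.appLE_eq_app, ← Scheme.Hom.appLE_eq_app]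
  refine (a'.appLE_comp_appLE V.ι V ⊤ ⊤ _ le_top).trans
    (Eq.trans ?_ (b'.appLE_comp_appLE V.ι V ⊤ ⊤ _ le_top).symm)
  ext r
  exact h r

variable {π : Y ⟶ X} {H N : X.Modules}
  {ι : N ⟶ (Scheme.Modules.pushforward π).obj (structureModule Y)}
  {n n' : ℕ} {f : X ⟶ projectiveSpace n} {s : Fin (n + 1) → Γ(H, ⊤)}
  {g : Y ⟶ projectiveSpace n'} {τ : Fin (n' + 1) → Γ((Scheme.Modules.pullback π).obj H, ⊤)}
  {k l : Fin (n + 1)} {k' l' : Fin (n' + 1)}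

/-- Locally s_k = a • e and π^*s_k = π^♯(a) • π^*e, and the nonvanishing locus of π^♯(a) is the
preimage of that of a. -/
lemma preimage_chart_eq (hf : IsGivenBySections f H s)
    (hg : IsGivenBySections g ((Scheme.Modules.pullback π).obj H) τ)
    (hk : τ k' = pullbackSection π (s k)) : g ⁻¹ᵁ chart k' = π ⁻¹ᵁ (f ⁻¹ᵁ chart k) := by
  have key : ∀ y : Y, ∃ U : X.Opens, π y ∈ U ∧
      π ⁻¹ᵁ U ⊓ g ⁻¹ᵁ chart k' = π ⁻¹ᵁ (U ⊓ f ⁻¹ᵁ chart k) := fun y => by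
    obtain ⟨U, e, hy, he⟩ := hf.isLineBundle (π y)
    obtain ⟨a, ha⟩ := he.exists_smul (res le_top (s k))
    refine ⟨U, hy, ?_⟩
    have h1 : res le_top (τ k') = (π.app U).hom a • pullbackSection π e := by
      rw [hk, ← pullbackSection_smul, ← ha]
      exact (pullbackSection_res π le_top (s k)).symm
    rw [hg.preimage_inf (he.pullbackSection π) h1, hf.preimage_inf he ha]
    exact (Scheme.preimage_basicOpen π a).symm
  ext y
  obtain ⟨U, hy, h⟩ := key y
  have := congrArg (y ∈ ·) h
  constructor
  · intro h1
    have h2 : y ∈ π ⁻¹ᵁ U ⊓ g ⁻¹ᵁ chart k' := ⟨hy, h1⟩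
    rw [h] at h2
    exact h2.2
  · intro h1
    have h2 : y ∈ π ⁻¹ᵁ (U ⊓ f ⁻¹ᵁ chart k) := ⟨hy, h1⟩
    rw [← h] at h2
    exact h2.2

lemma coordFn_eq_app (hf : IsGivenBySections f H s)
    (hg : IsGivenBySections g ((Scheme.Modules.pullback π).obj H) τ)
    (hk : τ k' = pullbackSection π (s k)) (hl : τ l' = pullbackSection π (s l)) {V : X.Opens}
    (hV : V ≤ f ⁻¹ᵁ chart k) (hV' : π ⁻¹ᵁ V ≤ g ⁻¹ᵁ chart k') :
    coordFn g k' l' hV' = (π.app V).hom (coordFn f k l hV) := by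
  have h1 : res (le_top : π ⁻¹ᵁ V ≤ ⊤) (τ k') = pullbackSection π (res le_top (s k)) := by
    rw [hk]
    exact (pullbackSection_res π le_top (s k)).symm
  have h2 : res (le_top : π ⁻¹ᵁ V ≤ ⊤) (τ l') = pullbackSection π (res le_top (s l)) := by
    rw [hl]
    exact (pullbackSection_res π le_top (s l)).symm
  refine ((hf.isFrame hV).pullbackSection π).smul_inj ?_
  rw [← h1, ← hg.res_eq hV', h2, hf.res_eq hV, pullbackSection_smul, h1]

lemma comp_eq_of_chart (hf : IsGivenBySections f H s)
    (hg : IsGivenBySections g ((Scheme.Modules.pullback π).obj H) τ) {c : Fin (n + 1) → Fin (n' + 1)}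
    (hc : ∀ k, τ (c k) = pullbackSection π (s k))
    (hq : g ≫ projectiveSpace.toSpec n' = π ≫ f ≫ projectiveSpace.toSpec n)
    {a b : T ⟶ Y} (hab : a ≫ g = b ≫ g) (k : Fin (n + 1)) (ha : ⊤ ≤ (a ≫ g) ⁻¹ᵁ chart (c k)) :
    a ≫ π ≫ f = b ≫ π ≫ f := by
  have hb : ⊤ ≤ (b ≫ g) ⁻¹ᵁ chart (c k) := by
    rw [← hab]
    exact ha
  have e := preimage_chart_eq hf hg (hc k)
  have hV : π ⁻¹ᵁ (f ⁻¹ᵁ chart k) ≤ g ⁻¹ᵁ chart (c k) := e.ge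
  have htop : ∀ u : T ⟶ Y, ⊤ ≤ (u ≫ g) ⁻¹ᵁ chart (c k) → ⊤ ≤ u ⁻¹ᵁ (π ⁻¹ᵁ (f ⁻¹ᵁ chart k)) :=
    fun u hu t ht => e.le (hu ht)
  have key : ∀ (u : T ⟶ Y) (hu : ⊤ ≤ (u ≫ g) ⁻¹ᵁ chart (c k)) (h : ⊤ ≤ (u ≫ π ≫ f) ⁻¹ᵁ chart k)
      (l : Fin (n + 1)), coordFn (u ≫ π ≫ f) k l h = coordFn (u ≫ g) (c k) (c l) hu := by
    intro u hu h l
    have h2 := coordFn_comp f π (l := l) (k := k) (W := f ⁻¹ᵁ chart k)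
      (V := π ⁻¹ᵁ (f ⁻¹ᵁ chart k)) le_rfl le_rfl le_rfl
    rw [Scheme.Hom.appLE_eq_app, ← coordFn_eq_app hf hg (hc k) (hc l) le_rfl hV] at h2
    rw [coordFn_comp g u hV (htop u hu), ← h2]
    exact coordFn_comp (π ≫ f) u _ _ _
  refine projective_hom_ext k (htop a ha) (htop b hb) ?_ fun l => ?_
  · simp only [Category.assoc]
    rw [← hq, ← Category.assoc, hab, Category.assoc]
  · refine (key a ha (htop a ha) l).trans (Eq.trans ?_ (key b hb (htop b hb) l).symm)
    congr 1

/-- The homogeneous coordinates of f ∘ π occur among those of g, so g determines f ∘ π, and f is a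
monomorphism. -/
lemma comp_eq_comp (hf : IsGivenBySections f H s) [Mono f]
    (hg : IsGivenBySections g ((Scheme.Modules.pullback π).obj H) τ) {c : Fin (n + 1) → Fin (n' + 1)}
    (hc : ∀ k, τ (c k) = pullbackSection π (s k))
    (hq : g ≫ projectiveSpace.toSpec n' = π ≫ f ≫ projectiveSpace.toSpec n)
    {a b : T ⟶ Y} (hab : a ≫ g = b ≫ g) : a ≫ π = b ≫ π := by
  rw [← cancel_mono f, Category.assoc, Category.assoc]
  refine hom_ext_of_nhds fun t => ?_
  obtain ⟨k, hk⟩ := exists_mem_chart ((a ≫ π ≫ f) t)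
  have hk' : (a ≫ g) t ∈ chart (c k) := (preimage_chart_eq hf hg (hc k)).ge hk
  refine ⟨(a ≫ g) ⁻¹ᵁ chart (c k), hk', ?_⟩
  have h := comp_eq_of_chart (a := ((a ≫ g) ⁻¹ᵁ chart (c k)).ι ≫ a)
    (b := ((a ≫ g) ⁻¹ᵁ chart (c k)).ι ≫ b) hf hg hc hq (by
      rw [Category.assoc, hab, Category.assoc]) k (by
      rw [Category.assoc]
      exact fun z _ => z.2)
  rwa [Category.assoc, Category.assoc] at h

/-- A map to the affine π⁻¹U is determined by its effect on functions x + y w from X and w = ι(ε).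
The functions from X are controlled by composition with π, and w by composition with g. -/
lemma eq_of_comp_eq_of_affine (hf : IsGivenBySections f H s)
    (hg : IsGivenBySections g ((Scheme.Modules.pullback π).obj H) τ)
    (hk : τ k' = pullbackSection π (s k)) {U : X.Opens} (hU : IsAffineOpen (π ⁻¹ᵁ U))
    (hUk : U ≤ f ⁻¹ᵁ chart k) (hι : Function.Surjective fun a : Γ(X, U) × Γ(N, U) =>
      (π.app U).hom a.1 + liftFn ι a.2) {e : Γ(H, U)} {ε : Γ(N, U)} (he : IsFrame e)
    (hε : IsFrame ε) (hl : res le_top (τ l') = liftFn ι ε • pullbackSection π e)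
    {a b : T ⟶ Y} (hab : a ≫ g = b ≫ g) (hab' : a ≫ π = b ≫ π) (ha : ⊤ ≤ (a ≫ π) ⁻¹ᵁ U) :
    a = b := by
  have hb : ⊤ ≤ (b ≫ π) ⁻¹ᵁ U := by
    rw [← hab']
    exact ha
  have hV : π ⁻¹ᵁ U ≤ g ⁻¹ᵁ chart k' := by
    rw [preimage_chart_eq hf hg hk]
    exact preimage_le_preimage π hUk
  obtain ⟨r, hr⟩ := he.exists_smul (res le_top (s k))
  -- Compare coefficients of π^*e in τ_l' = (x_l'/x_k') • τ_k', where τ_k' = π^*(r • e).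
  have hw : liftFn ι ε = coordFn g k' l' hV * (π.app U).hom r := by
    refine (he.pullbackSection π).smul_inj ?_
    rw [← hl, hg.res_eq hV, mul_smul, ← pullbackSection_smul, ← hr, hk]
    exact congrArg _ (pullbackSection_res π le_top (s k)).symm
  have hπ : ∀ (u : T ⟶ Y) (hu : ⊤ ≤ (u ≫ π) ⁻¹ᵁ U) (x : Γ(X, U)),
      (u.appLE (π ⁻¹ᵁ U) ⊤ hu).hom ((π.app U).hom x) = ((u ≫ π).appLE U ⊤ hu).hom x := by
    intro u hu x
    rw [← Scheme.Hom.appLE_eq_app]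
    exact appLE_appLE u π le_rfl hu x
  have hg' : ∀ (u : T ⟶ Y) (hu : ⊤ ≤ (u ≫ π) ⁻¹ᵁ U),
      (u.appLE (π ⁻¹ᵁ U) ⊤ hu).hom (coordFn g k' l' hV) =
        coordFn (u ≫ g) k' l' (fun _ ht => hV (hu ht)) := fun u hu =>
    (coordFn_comp g u hV hu _).symm
  have hπab : ∀ x : Γ(X, U), ((a ≫ π).appLE U ⊤ ha).hom x = ((b ≫ π).appLE U ⊤ hb).hom x := by
    intro x
    congr 3
  have hgab : coordFn (a ≫ g) k' l' (fun _ ht => hV (ha ht)) =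
      coordFn (b ≫ g) k' l' (fun _ ht => hV (hb ht)) := by
    congr 1
  refine hom_ext_of_appLE hU ha hb fun r' => ?_
  obtain ⟨x, y, rfl⟩ := exists_eq_add_mul hι hε r'
  rw [hw, map_add, map_add, map_mul, map_mul, map_mul, map_mul, hπ a, hπ a, hπ a, hπ b, hπ b, hπ b,
    hg' a, hg' b, hπab, hπab, hπab, hgab]

lemma mono_of_sections [IsAffineHom π] (hf : IsGivenBySections f H s) [Mono f]
    (hι : ∀ U : X.Opens, Function.Bijective fun a : Γ(X, U) × Γ(N, U) =>
      (π.app U).hom a.1 + liftFn ι a.2)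
    (hg : IsGivenBySections g ((Scheme.Modules.pullback π).obj H) τ) {c : Fin (n + 1) → Fin (n' + 1)}
    (hc : ∀ k, τ (c k) = pullbackSection π (s k))
    (hq : g ≫ projectiveSpace.toSpec n' = π ≫ f ≫ projectiveSpace.toSpec n)
    (h : ∀ x : X, ∃ (l : Fin (n' + 1)) (U : X.Opens) (e : Γ(H, U)) (ε : Γ(N, U)), x ∈ U ∧
      IsFrame e ∧ IsFrame ε ∧ res le_top (τ l) = liftFn ι ε • pullbackSection π e) : Mono g := by
  refine ⟨fun {T} a b hab => hom_ext_of_nhds fun t => ?_⟩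
  have hab' := comp_eq_comp hf hg hc hq hab
  obtain ⟨l, U, e, ε, hxU, he, hε, hl⟩ := h ((a ≫ π) t)
  obtain ⟨k, hk⟩ := exists_mem_chart (f ((a ≫ π) t))
  obtain ⟨W, hW, hxW, hWU⟩ := exists_isAffineOpen_mem_and_subset (U := U ⊓ f ⁻¹ᵁ chart k) ⟨hxU, hk⟩
  have h1 : W ≤ U := hWU.trans inf_le_left
  have h2 := congrArg (res (preimage_le_preimage π h1)) hl
  rw [res_res, res_liftFn_smul h1] at h2
  refine ⟨(a ≫ π) ⁻¹ᵁ W, hxW, ?_⟩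
  refine eq_of_comp_eq_of_affine hf hg (hc k) (hW.preimage π) (hWU.trans inf_le_right) (hι W).2
    (he.res h1) (hε.res h1) h2 ?_ ?_ ?_
  · rw [Category.assoc, hab, Category.assoc]
  · rw [Category.assoc, hab', Category.assoc]
  · rw [Category.assoc]
    exact fun z _ => z.2

end Mono

/-! ### Global generation implies very ampleness -/

section Backward

variable {X Y : Scheme.{0}} {π : Y ⟶ X} {H N L : X.Modules}
  {ι : N ⟶ (Scheme.Modules.pushforward π).obj (structureModule Y)}

lemma exists_finite_frames [CompactSpace X] {I : Type} (v : I → Γ(L, ⊤))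
    (h : ∀ x : X, ∃ (i : I) (U : X.Opens), x ∈ U ∧ IsFrame (res (le_top : U ≤ ⊤) (v i))) :
    ∃ (J : ℕ) (v' : Fin J → Γ(L, ⊤)), ∀ x : X, ∃ (j : Fin J) (U : X.Opens), x ∈ U ∧
      IsFrame (res (le_top : U ≤ ⊤) (v' j)) := by
  choose i U hxU hU using h
  obtain ⟨t, ht⟩ := isCompact_univ.elim_finite_subcover (fun x : X => (U x : Set X))
    (fun x => (U x).isOpen) (fun x _ => Set.mem_iUnion.2 ⟨x, hxU x⟩)
  refine ⟨t.card, fun j => v (i (t.equivFin.symm j)), fun x => ?_⟩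
  obtain ⟨z, hz, hxz⟩ := Set.mem_iUnion₂.1 (ht (Set.mem_univ x))
  refine ⟨t.equivFin ⟨z, hz⟩, U z, hxz, ?_⟩
  simp only [Equiv.symm_apply_apply]
  exact hU z

lemma isFrame_of_tmul {U : X.Opens} {e : Γ(H, U)} {m : Γ(N, U)} (he : IsFrame e)
    (hN : IsLineBundle N) (h : IsFrame (tmul e m)) : IsFrame m := by
  refine isFrame_of_nhds fun x hx => ?_
  obtain ⟨V, ε, hxV, hε⟩ := hN x
  have hε' := hε.res (inf_le_right : U ⊓ V ≤ V)
  have he' := he.res (inf_le_left : U ⊓ V ≤ U)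
  refine ⟨U ⊓ V, inf_le_left, ⟨hx, hxV⟩, ?_⟩
  have h' := h.res (inf_le_left : U ⊓ V ≤ U)
  obtain ⟨a, ha⟩ := hε'.exists_smul (res inf_le_left m)
  rw [res_tmul, ha, tmul_smul] at h'
  rw [ha]
  exact hε'.smul_of_isUnit ((he'.tmul hε').isUnit_of_smul h')

lemma isVeryAmple_pullback [IsAffineHom π] {p : X ⟶ Spec (.of ℂ)} (hH : IsVeryAmple p H)
    (hN : IsLineBundle N) (hι : ∀ U : X.Opens, Function.Bijective fun a : Γ(X, U) × Γ(N, U) =>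
      (π.app U).hom a.1 + liftFn ι a.2) (h : IsGloballyGenerated (tensor H N)) :
    IsVeryAmple (π ≫ p) ((Scheme.Modules.pullback π).obj H) := by
  obtain ⟨n, f, s, hf, rfl, hs⟩ := hH
  have hHl := hs.isLineBundle
  have : CompactSpace X := (quasiCompact_iff_compactSpace (f ≫ projectiveSpace.toSpec n)).1
    inferInstance
  obtain ⟨I, v₀, hv₀⟩ := exists_frames_of_isGloballyGenerated (hHl.tensor hN) h
  obtain ⟨J, v, hv⟩ := exists_finite_frames v₀ hv₀
  choose t ht using fun j => exists_pullback_section ι hHl (v j)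
  obtain ⟨E⟩ : Nonempty (Fin (n + 1) ⊕ Fin J ≃ Fin (n + J + 1)) :=
    ⟨Fintype.equivFinOfCardEq (by simp; ring)⟩
  let τ : Fin (n + J + 1) → Γ((Scheme.Modules.pullback π).obj H, ⊤) := fun l =>
    Sum.elim (fun k => (show Γ((Scheme.Modules.pullback π).obj H, ⊤) from pullbackSection π (s k)))
      t (E.symm l)
  have hτ : ∀ k, τ (E (Sum.inl k)) = pullbackSection π (s k) := fun k => by
    simp only [τ, Equiv.symm_apply_apply]
    rfl
  have hτ' : ∀ j, τ (E (Sum.inr j)) = t j := fun j => by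
    simp only [τ, Equiv.symm_apply_apply]
    rfl
  obtain ⟨g, hgq, hg⟩ := exists_isGivenBySections (π ≫ f ≫ projectiveSpace.toSpec n) τ fun y => by
    obtain ⟨k, hk⟩ := exists_mem_chart (f (π y))
    refine ⟨E (Sum.inl k), π ⁻¹ᵁ (f ⁻¹ᵁ chart k), hk, ?_⟩
    rw [hτ]
    have h1 := (hs k).1.pullbackSection π
    rw [pullbackSection_res] at h1
    exact h1
  have hmono : Mono g := by
    refine mono_of_sections hs hι hg (c := fun k => E (Sum.inl k)) hτ hgq fun x => ?_
    obtain ⟨j, V, hxV, hV⟩ := hv x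
    obtain ⟨U, e, hxU, he⟩ := hHl x
    have hU := hV.res (inf_le_left : V ⊓ U ≤ V)
    rw [res_res] at hU
    have he' := he.res (inf_le_right : V ⊓ U ≤ U)
    obtain ⟨m, hm⟩ := he'.tmul_surj (res le_top (v j))
    rw [hm] at hU
    refine ⟨E (Sum.inr j), V ⊓ U, _, m, ⟨hxV, hxU⟩, he', isFrame_of_tmul he' hN hU, ?_⟩
    rw [hτ']
    exact ht j _ _ _ he' hm
  have : IsFinite π := isFinite_of_bijective hN hι
  -- The composite is Y ⟶ X ⟶ ℙ^n ⟶ Spec ℂ, a finite map, a closed immersion and a proper map.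
  -- Properness then cancels to g.
  have : IsProper (g ≫ projectiveSpace.toSpec (n + J)) := by
    rw [hgq]
    infer_instance
  have : IsProper g := IsProper.of_comp g (projectiveSpace.toSpec (n + J))
  exact ⟨n + J, g, τ, (IsClosedImmersion.iff_isProper_and_mono g).2 ⟨this, hmono⟩, hgq, hg⟩

end Backward

/-! ### Two distinct points in a fibre of rank two -/

section Algebra

/-- Take R = K ⊗ (C ⊗ C) over A with the two inclusions of C, the universal pair of points of the
fibre. As C is free on 1, w, the elements w ⊗ 1 and 1 ⊗ w are distinct members of a K-basis of R.
Split, nonsplit and nonreduced fibres are treated alike. -/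
lemma exists_ringHom_pair {A C K : Type} [CommRing A] [CommRing C] [Field K] (φ : A →+* C) (w : C)
    (h : Function.Bijective fun a : A × A => φ a.1 + φ a.2 * w) (ψ : A →+* K) :
    ∃ (R : Type) (_ : CommRing R) (θ : K →+* R) (α β : C →+* R),
      (∀ a, α (φ a) = θ (ψ a)) ∧ (∀ a, β (φ a) = θ (ψ a)) ∧ α w ≠ β w := by
  algebraize [φ, ψ]
  have hsmul : ∀ (a : A) (c : C), a • c = φ a * c := fun a c => Algebra.smul_def a c
  let b : Module.Basis (Fin 2) A C := Module.Basis.mk (v := ![1, w])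
    (LinearIndependent.pair_iff.2 fun s t hst => by
      rw [hsmul, hsmul, mul_one] at hst
      have := h.1 (a₁ := (s, t)) (a₂ := (0, 0)) (by simpa using hst)
      exact ⟨(Prod.ext_iff.1 this).1, (Prod.ext_iff.1 this).2⟩) (fun c _ => by
      obtain ⟨⟨s, t⟩, rfl⟩ := h.2 c
      rw [Matrix.range_cons, Matrix.range_cons, Matrix.range_empty, Set.union_empty,
        Set.singleton_union, Submodule.mem_span_pair]
      exact ⟨s, t, by rw [hsmul, hsmul, mul_one]⟩)
  have hb0 : b 0 = 1 := by simp [b]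
  have hb1 : b 1 = w := by simp [b]
  let B := Algebra.TensorProduct.basis K (b.tensorProduct b)
  have hB : ∀ i j, B (i, j) = 1 ⊗ₜ (b i ⊗ₜ b j) := fun i j => by
    simp [B, Module.Basis.tensorProduct_apply]
  let r : C ⊗[A] C →ₐ[A] K ⊗[A] (C ⊗[A] C) := Algebra.TensorProduct.includeRight
  refine ⟨K ⊗[A] (C ⊗[A] C), inferInstance, algebraMap K _,
    (r.comp Algebra.TensorProduct.includeLeft).toRingHom,
    (r.comp Algebra.TensorProduct.includeRight).toRingHom, fun a => ?_, fun a => ?_, fun e => ?_⟩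
  · exact ((r.comp Algebra.TensorProduct.includeLeft).commutes a).trans
      (IsScalarTower.algebraMap_apply A K _ a)
  · exact ((r.comp Algebra.TensorProduct.includeRight).commutes a).trans
      (IsScalarTower.algebraMap_apply A K _ a)
  · have e' : B (1, 0) = B (0, 1) := by
      rw [hB, hB, hb0, hb1]
      exact e
    simpa using B.injective e'

end Algebra

/-! ### Very ampleness implies global generation -/

section Forward

variable {T X Y : Scheme.{0}} {π : Y ⟶ X} {H N L : X.Modules} {U : X.Opens}
  {ι : N ⟶ (Scheme.Modules.pushforward π).obj (structureModule Y)}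

lemma exists_hom_of_ringHom {V : Y.Opens} (hV : IsAffineOpen V) (α : Γ(Y, V) ⟶ Γ(T, ⊤)) :
    ∃ (a : T ⟶ Y) (ha : ⊤ ≤ a ⁻¹ᵁ V), ∀ r, (a.appLE V ⊤ ha).hom r = α.hom r := by
  have hf : ⊤ ≤ hV.fromSpec ⁻¹ᵁ V := hV.fromSpec_preimage_self.ge
  refine ⟨(T.toSpecΓ ≫ Spec.map α) ≫ hV.fromSpec, fun t _ => hf (Set.mem_univ _), fun r => ?_⟩
  have h2 : hV.fromSpec.appLE V ⊤ hf = (Scheme.ΓSpecIso Γ(Y, V)).inv := by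
    rw [Scheme.Hom.appLE, hV.fromSpec_app_self, Category.assoc, ← Functor.map_comp]
    exact Category.comp_id _
  have h3 : (Scheme.ΓSpecIso Γ(Y, V)).inv ≫ (T.toSpecΓ ≫ Spec.map α).appLE ⊤ ⊤ le_top = α := by
    change _ ≫ (T.toSpecΓ ≫ Spec.map α).appLE ⊤ ((T.toSpecΓ ≫ Spec.map α) ⁻¹ᵁ ⊤) le_rfl = α
    rw [Scheme.Hom.appLE_eq_app]
    simp
  rw [← appLE_appLE (T.toSpecΓ ≫ Spec.map α) hV.fromSpec hf le_top, h2]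
  exact congrArg (fun t => t.hom r) h3

variable {n : ℕ} {g : Y ⟶ projectiveSpace n}

/-- The c l pulled back to T are homogeneous coordinates of the composite with g; equal coordinates,
one of them a unit, give equal maps to projective space. -/
lemma comp_eq_of_appLE_eq {L : Y.Modules} {τ : Fin (n + 1) → Γ(L, ⊤)}
    (hg : IsGivenBySections g L τ) {V : Y.Opens} {e : Γ(L, V)} (he : IsFrame e)
    {c : Fin (n + 1) → Γ(Y, V)} (hc : ∀ l, res le_top (τ l) = c l • e) {a b : T ⟶ Y}
    (hab : a ≫ g ≫ projectiveSpace.toSpec n = b ≫ g ≫ projectiveSpace.toSpec n)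
    (ha : ⊤ ≤ a ⁻¹ᵁ V) (hb : ⊤ ≤ b ⁻¹ᵁ V)
    (h : ∀ l, (a.appLE V ⊤ ha).hom (c l) = (b.appLE V ⊤ hb).hom (c l)) (k : Fin (n + 1))
    (hk : IsUnit ((a.appLE V ⊤ ha).hom (c k))) : a ≫ g = b ≫ g := by
  have key : ∀ (u : T ⟶ Y) (hu : ⊤ ≤ u ⁻¹ᵁ V), IsUnit ((u.appLE V ⊤ hu).hom (c k)) →
      ∃ hu' : ⊤ ≤ (u ≫ g) ⁻¹ᵁ chart k, ∀ l,
        coordFn (u ≫ g) k l hu' * (u.appLE V ⊤ hu).hom (c k) = (u.appLE V ⊤ hu).hom (c l) := by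
    intro u hu hunit
    have h1 := Scheme.basicOpen_appLE u ⊤ V hu (c k)
    have h2 : T.basicOpen ((u.appLE V ⊤ hu).hom (c k)) = ⊤ := Scheme.basicOpen_of_isUnit _ hunit
    have h3 : ⊤ ≤ u ⁻¹ᵁ (Y.basicOpen (c k)) := h2.ge.trans (h1.le.trans inf_le_right)
    have h4 := hg.preimage_inf he (hc k)
    have h5 : Y.basicOpen (c k) ≤ g ⁻¹ᵁ chart k := h4.ge.trans inf_le_right
    have h6 : Y.basicOpen (c k) ≤ V := Y.basicOpen_le _
    have hu' : ⊤ ≤ (u ≫ g) ⁻¹ᵁ chart k := fun t ht => h5 (h3 ht)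
    refine ⟨hu', fun l => ?_⟩
    have h7 : coordFn g k l h5 * resO h6 (c k) = resO h6 (c l) := by
      refine (he.res h6).smul_inj ?_
      rw [mul_smul, ← res_smul, ← res_smul, ← hc, ← hc, res_res, res_res]
      exact (hg.res_eq h5 l).symm
    have h8 := congrArg (u.appLE _ ⊤ h3).hom h7
    rw [map_mul, appLE_resO, appLE_resO, ← coordFn_comp g u h5 h3 hu'] at h8
    exact h8
  obtain ⟨ha', hA⟩ := key a ha hk
  obtain ⟨hb', hB⟩ := key b hb (h k ▸ hk)
  refine projective_hom_ext k ha' hb' (by rw [Category.assoc, hab, Category.assoc]) fun l => ?_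
  refine hk.mul_right_cancel ?_
  rw [hA, h, h, hB]

/-- If all b_l vanish at x, the two R-points of the fibre see only the scalars u_l(x) as coordinates
of g, so g identifies them although they differ on w = ι(ε). -/
lemma exists_mem_basicOpen_of_mono [IsAffineHom π] [Mono g]
    {τ : Fin (n + 1) → Γ((Scheme.Modules.pullback π).obj H, ⊤)}
    (hg : IsGivenBySections g ((Scheme.Modules.pullback π).obj H) τ) {p : X ⟶ Spec (.of ℂ)}
    (hp : g ≫ projectiveSpace.toSpec n = π ≫ p) (hU : IsAffineOpen U)
    (hι : Function.Bijective fun a : Γ(X, U) × Γ(N, U) => (π.app U).hom a.1 + liftFn ι a.2)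
    {e : Γ(H, U)} {ε : Γ(N, U)} (he : IsFrame e) (hε : IsFrame ε) {u b : Fin (n + 1) → Γ(X, U)}
    (hτ : ∀ l, res le_top (τ l) =
      ((π.app U).hom (u l) + liftFn ι (b l • ε)) • pullbackSection π e) {x : X} (hx : x ∈ U) :
    ∃ l, x ∈ X.basicOpen (b l) := by
  by_contra! hb
  have hbij : Function.Bijective fun a : Γ(X, U) × Γ(X, U) =>
      (π.app U).hom a.1 + (π.app U).hom a.2 * liftFn ι ε := by
    refine ⟨fun a a' h => ?_, fun c => ?_⟩
    · have h' := hι.1 (a₁ := (a.1, a.2 • ε)) (a₂ := (a'.1, a'.2 • ε)) (by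
        simpa only [liftFn_smul] using h)
      exact Prod.ext (Prod.ext_iff.1 h').1 (hε.smul_inj (Prod.ext_iff.1 h').2)
    · obtain ⟨a, a', h⟩ := exists_eq_add_mul hι.2 hε c
      exact ⟨(a, a'), h.symm⟩
  let ψ := (X.evaluation U x hx).hom
  have hψ : ∀ l, ψ (b l) = 0 := fun l =>
    (X.evaluation_eq_zero_iff_notMem_basicOpen x hx (b l)).2 (hb l)
  obtain ⟨R, _, θ, α, β, hα, hβ, hne⟩ := exists_ringHom_pair (π.app U).hom (liftFn ι ε) hbij ψ
  have hR : Nontrivial R := ⟨⟨_, _, hne⟩⟩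
  let σ := (Scheme.ΓSpecIso (.of R)).inv
  have hV := hU.preimage π
  obtain ⟨f₁, h₁, hf₁⟩ := exists_hom_of_ringHom (T := Spec (.of R)) hV (CommRingCat.ofHom α ≫ σ)
  obtain ⟨f₂, h₂, hf₂⟩ := exists_hom_of_ringHom (T := Spec (.of R)) hV (CommRingCat.ofHom β ≫ σ)
  have hπ₁ : ∀ r, (f₁.appLE _ ⊤ h₁).hom ((π.app U).hom r) = σ.hom (θ (ψ r)) := fun r =>
    (hf₁ _).trans (congrArg σ.hom (hα r))
  have hπ₂ : ∀ r, (f₂.appLE _ ⊤ h₂).hom ((π.app U).hom r) = σ.hom (θ (ψ r)) := fun r =>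
    (hf₂ _).trans (congrArg σ.hom (hβ r))
  have hf : f₁ ≫ π = f₂ ≫ π := by
    refine hom_ext_of_appLE hU h₁ h₂ fun r => ?_
    have e₁ := appLE_appLE f₁ π (le_refl (π ⁻¹ᵁ U)) h₁ r
    have e₂ := appLE_appLE f₂ π (le_refl (π ⁻¹ᵁ U)) h₂ r
    rw [Scheme.Hom.appLE_eq_app] at e₁ e₂
    rw [← e₁, ← e₂, hπ₁, hπ₂]
  let c : Fin (n + 1) → Γ(Y, π ⁻¹ᵁ U) := fun l => (π.app U).hom (u l) + liftFn ι (b l • ε)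
  have hc₁ : ∀ l, (f₁.appLE _ ⊤ h₁).hom (c l) = σ.hom (θ (ψ (u l))) := fun l => by
    simp only [c, liftFn_smul]
    rw [map_add, map_mul, hπ₁, hπ₁, hψ, map_zero, map_zero, zero_mul, add_zero]
  have hc₂ : ∀ l, (f₂.appLE _ ⊤ h₂).hom (c l) = σ.hom (θ (ψ (u l))) := fun l => by
    simp only [c, liftFn_smul]
    rw [map_add, map_mul, hπ₂, hπ₂, hψ, map_zero, map_zero, zero_mul, add_zero]
  -- R is nontrivial, so there is a point z; a chart containing its image provides an index k with
  -- u_k(x) ≠ 0, a unit of κ(x) and hence of R.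
  let z : Spec (CommRingCat.of R) := Classical.arbitrary (PrimeSpectrum R)
  obtain ⟨k, hk⟩ := exists_mem_chart (g (f₁ z))
  have hpe := he.pullbackSection π
  have hz : f₁ z ∈ Y.basicOpen (c k) := by
    rw [← hg.preimage_inf hpe (hτ k)]
    exact ⟨h₁ (Set.mem_univ z), hk⟩
  have hzu : ψ (u k) ≠ 0 := fun h0 => by
    have h3 := Scheme.basicOpen_appLE f₁ ⊤ _ h₁ (c k)
    have h4 : z ∈ (⊤ : (Spec (CommRingCat.of R)).Opens) ⊓ f₁ ⁻¹ᵁ Y.basicOpen (c k) := ⟨trivial, hz⟩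
    rw [← h3] at h4
    have h5 : (f₁.appLE _ ⊤ h₁).hom (c k) = 0 := by rw [hc₁, h0, map_zero, map_zero]
    have h6 : (Spec (CommRingCat.of R)).basicOpen ((f₁.appLE _ ⊤ h₁).hom (c k)) = ⊥ := by
      rw [h5]
      exact Scheme.basicOpen_zero _ _
    exact (h6.le h4)
  have hfg : f₁ ≫ g = f₂ ≫ g := by
    refine comp_eq_of_appLE_eq hg hpe hτ ?_ h₁ h₂ (fun l => (hc₁ l).trans (hc₂ l).symm) k ?_
    · rw [hp, ← Category.assoc, hf, Category.assoc]
    · have : IsUnit (σ.hom (θ (ψ (u k)))) := ((isUnit_iff_ne_zero.2 hzu).map θ).map σ.hom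
      rw [← hc₁] at this
      exact this
  have hff : f₁ = f₂ := (cancel_mono g).1 hfg
  apply hne
  have h7 : σ.hom (α (liftFn ι ε)) = σ.hom (β (liftFn ι ε)) := by
    refine (hf₁ _).symm.trans (Eq.trans ?_ (hf₂ _))
    subst hff
    rfl
  exact (ConcreteCategory.bijective_of_isIso σ).1 h7

lemma isGloballyGenerated_tensor [IsAffineHom π] {p : X ⟶ Spec (.of ℂ)} (hH : IsLineBundle H)
    (hN : IsLineBundle N) (hι : ∀ U : X.Opens, Function.Bijective fun a : Γ(X, U) × Γ(N, U) =>
      (π.app U).hom a.1 + liftFn ι a.2)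
    (h : IsVeryAmple (π ≫ p) ((Scheme.Modules.pullback π).obj H)) :
    IsGloballyGenerated (tensor H N) := by
  obtain ⟨n, g, τ, hcl, hp, hg⟩ := h
  choose v hv using fun l => exists_tensor_section hH hι (τ l)
  refine isGloballyGenerated_of_frames v fun x => ?_
  obtain ⟨U, e, ε, hx, hU, he, hε⟩ := exists_affine_frame hH hN x
  have h1 : ∀ l, ∃ u b : Γ(X, U), res le_top (τ l) =
      ((π.app U).hom u + liftFn ι (b • ε)) • pullbackSection π e := fun l => by
    obtain ⟨c, hc⟩ := (he.pullbackSection π).exists_smul (res le_top (τ l))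
    obtain ⟨a, b, rfl⟩ := exists_eq_add_mul (hι U).2 hε c
    exact ⟨a, b, by rw [liftFn_smul]; exact hc⟩
  choose u b hub using h1
  obtain ⟨l, hl⟩ := exists_mem_basicOpen_of_mono hg hp hU (hι U) he hε hub hx
  refine ⟨l, X.basicOpen (b l), hl, ?_⟩
  -- Over U the section v_l is b_l • (e ⊗ ε), hence a frame where b_l is invertible.
  have h2 := isFrame_res_basicOpen (he.tmul hε) (b l)
  rwa [← tmul_smul, ← hv l U e (u l) _ he (hub l), res_res] at h2

end Forward

end DoubleCover

end

theorem lemma2p1 (n : ℕ) (hn : 2 ≤ n)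
    (X : Scheme.{0}) (p : X ⟶ Spec (.of ℂ)) [IsIntegral X] [SmoothOfRelativeDimension n p]
    (hX : DoubleCover.IsProjective p)
    (B : Scheme.{0}) (i : B ⟶ X) (hB : DoubleCover.IsSmoothDivisor p i)
    (M : X.Modules) (hM : DoubleCover.IsLineBundle M)
    (φ : DoubleCover.divisorModule i ≅ DoubleCover.tensor M M)
    (Y : Scheme.{0}) (π : Y ⟶ X) (hπ : DoubleCover.IsDoubleCover i φ π)
    (H : X.Modules) (hH : DoubleCover.IsVeryAmple p H) :
    DoubleCover.IsVeryAmple (π ≫ p) ((Scheme.Modules.pullback π).obj H) ↔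
      DoubleCover.IsGloballyGenerated (DoubleCover.tensor H (DoubleCover.inverse M)) := by
  obtain ⟨hπaff, ι, hι, -⟩ := hπ
  have hN := hM.inverse
  constructor
  · obtain ⟨N, f, s, -, -, hs⟩ := hH
    exact DoubleCover.isGloballyGenerated_tensor hs.isLineBundle hN hι
  · exact DoubleCover.isVeryAmple_pullback hH hN hι
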